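/- **Setting.** Let $q_0>0$, let $\sigma,x,t\in\mathbb R$, and let $\mathbf q_\pm\in\mathbb C^2$ satisfy $\|\mathbf q_\pm\|=q_0$ and $\mathbf q_+^\dagger\mathbf q_-\neq0$. For $\mathbf v=(v_1,v_2)^T$ put $\mathbf v^\perp=(\bar v_2,-\bar v_1)^T$. Put $k=\frac12(z+q_0^2/z)$, $\lambda=\frac12(z-q_0^2/z)$, $\widehat\rho(z)=z^2/(z^2-q_0^2)$, $$\delta_1=\lambda x+2\lambda[k+\sigma(3k^2-\lambda^2)]t,\qquad \delta_2=-kx-(\lambda^2+k^2+4\sigma k^3)t,\qquad \mathbf\Delta=\operatorname{diag}(\delta_1,\delta_2,-\delta_1).$$ Let $\mathbb D^\pm=\{z\in\mathbb C:\pm\operatorname{Im}z>0\}$. **Data.** Let $\beta_1,\beta_2:\mathbb R\to\mathbb C$ be functions and write $\widehat\beta_j(z)=\beta_j(q_0^2/z)$. For $z\in\mathbb R\setminus\{0,\pm q_0\}$ let $$\mathbf K=\begin{pmatrix} \mathrm i\widehat\rho(1+\beta_1^*\widehat\beta_1^*)-\mathrm i|\beta_2|^2+\frac{z}{q_0}\beta_1^*\beta_2^*\widehat\beta_2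 & \frac{z}{q_0}\widehat\beta_1^*\widehat\beta_2^*-\mathrm i\beta_2^*-\frac{\mathrm iz^2}{q_0^2\widehat\rho}\beta_2^*|\widehat\beta_2|^2 & \frac{\mathrm iz}{q_0\widehat\rho}\widehat\beta_2\beta_2^*-\widehat\beta_1^*\\ \beta_2+\frac{\mathrm iz}{q_0}\beta_1^*\widehat\beta_2 & 1+\frac{z^2}{q_0^2\widehat\rho}|\widehat\beta_2|^2 & -\frac{z}{q_0\widehat\rho}\widehat\beta_2\\ -\beta_1^* & \frac{\mathrm iz}{q_0\widehat\rho}\widehat\beta_2^* & \frac1{\mathrm i\widehat\rho} \end{pmatrix},\qquad \mathbf L=\mathbf K-\mathbf I .$$ Let $z_1,\dots,z_{M_1}\in\mathbb D^+$ be distinct with $|z_m|=q_0$ and $\theta_1,\dots,\theta_{M_2}\in\mathbb D^+$ distinct with $|\theta_m|<q_0$ ($M_1,M_2\ge0$). With arbitrary complex constants carrying the superscript $0$, let $$C_m=C_m^0\mathrm e^{-2\mathrm i\delta_1(z_m)},\quad \bar C_m=\bar C_m^0\mathrm e^{2\mathrm i\delta_1(z_m^*)},\quad F_m=F_m^0\mathrm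 e^{\mathrm i[\delta_2-\delta_1](\theta_m)},\quad \check F_m=\check F_m^0\mathrm e^{\mathrm i[\delta_2-\delta_1](\theta_m)},$$ $$\bar F_m=\bar F_m^0\mathrm e^{\mathrm i[\delta_1-\delta_2](\theta_m^*)},\quad \hat F_m=\hat F_m^0\mathrm e^{\mathrm i[\delta_1-\delta_2](\theta_m^*)}.$$ Let $$\mathbf R_\infty^+=\begin{pmatrix}\mathrm i&0&0\\ \mathbf 0&\frac{q_0\mathbf q_+^\perp}{\mathbf q_+^\dagger\mathbf q_-}&\frac{\mathbf q_-}{\mathrm iq_0}\end{pmatrix},\quad \mathbf R_\infty^-=\begin{pmatrix}1&0&0\\ \mathbf 0&\frac{\mathbf q_-^\perp}{q_0}&\frac{q_0\mathbf q_+}{\mathbf q_-^\dagger\mathbf q_+}\end{pmatrix},\quad \mathbf R_0^+=\begin{pmatrix}0&0&-\mathrm iq_0\\ \mathbf 0&\mathbf 0&\mathbf 0\end{pmatrix},\quad \mathbf R_0^-=\begin{pmatrix}0&0&0\\ \mathbf q_-&\mathbf 0&\mathbf 0\end{pmatrix}.$$ **The RH problem.** A solution is a pair of $3\times3$ matrix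 functions $\mathbf R^\pm=(\mathbf R_1^\pm,\mathbf R_2^\pm,\mathbf R_3^\pm)$ such that: 1. $\mathbf R^\pm$ is meromorphic in $\mathbb D^\pm$ and analytic except for at most simple poles of $\mathbf R_1^+$ at $z_m,\theta_m$, of $\mathbf R_2^+$ at $q_0^2/\theta_m^*$, of $\mathbf R_2^-$ at $\theta_m^*$, and of $\mathbf R_3^-$ at $z_m^*,q_0^2/\theta_m$. It extends continuously to $\mathbb R\setminus\{0,\pm q_0\}$ and is bounded near $\pm q_0$. 2. $\mathbf R^+=\mathbf R^-\mathrm e^{\mathrm i\mathbf\Delta}\mathbf K\mathrm e^{-\mathrm i\mathbf\Delta}$ on $\mathbb R\setminus\{0,\pm q_0\}$. 3. In $\mathbb D^\pm$, $\mathbf R^\pm=\mathbf R_\infty^\pm+O(1/z)$ as $z\to\infty$ and $\mathbf R^\pm=\frac1z\mathbf R_0^\pm+O(1)$ as $z\to0$. 4. The residues are (all columns not displayed vanish) $$\operatorname*{Res}_{z_m}\mathbf R^+=[\mathrm iC_m\widehat\rho(z_m)\mathbf R_3^+(z_m),\mathbf 0,\mathbf 0],\qquad \operatorname*{Res}_{z_m^*}\mathbf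 R^-=[\mathbf 0,\mathbf 0,\mathrm i\bar C_m\widehat\rho(z_m^*)\mathbf R_1^-(z_m^*)],$$ $$\operatorname*{Res}_{\theta_m}\mathbf R^+=[-F_m\mathbf R_2^+(\theta_m),\mathbf 0,\mathbf 0],\qquad \operatorname*{Res}_{\theta_m^*}\mathbf R^-=[\mathbf 0,\mathrm i\bar F_m\widehat\rho(\theta_m^*)\mathbf R_1^-(\theta_m^*),\mathbf 0],$$ $$\operatorname*{Res}_{q_0^2/\theta_m}\mathbf R^-=[\mathbf 0,\mathbf 0,\check F_m\mathbf R_2^-(q_0^2/\theta_m)],\qquad \operatorname*{Res}_{q_0^2/\theta_m^*}\mathbf R^+=[\mathbf 0,-\mathrm i\hat F_m\widehat\rho(q_0^2/\theta_m^*)\mathbf R_3^+(q_0^2/\theta_m^*),\mathbf 0].$$ **Theorem.** Let $(\mathbf R^+,\mathbf R^-)$ be a solution. Write $\mathbf R(z)=\mathbf R^\pm(z)$, $\mathbf R_\infty(z)=\mathbf R_\infty^\pm$, $\mathbf R_0(z)=\mathbf R_0^\pm$ for $z\in\mathbb D^\pm$, $\mathbf R_\infty^\nabla=\mathbf R_\infty^--\mathbf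 R_\infty^+$, $\mathbf R_0^\nabla=\mathbf R_0^--\mathbf R_0^+$ and $$\mathbf A(\zeta)=\mathbf R_\infty^\nabla+\tfrac1\zeta\mathbf R_0^\nabla+\mathbf R^-(\zeta)\mathrm e^{\mathrm i\mathbf\Delta(\zeta)}\mathbf L(\zeta)\mathrm e^{-\mathrm i\mathbf\Delta(\zeta)},\qquad \mathcal C(z)=\frac1{2\pi\mathrm i}\int_{\mathbb R}\frac{\mathbf A(\zeta)}{\zeta-z}\,\mathrm d\zeta ,$$ and let $\mathcal C_j$ be the $j$-th column of $\mathcal C$. The integral converges absolutely for every $z\notin\mathbb R$. For every $z\notin\mathbb R$ other than the points $z_m,z_m^*,\theta_m,\theta_m^*,q_0^2/\theta_m,q_0^2/\theta_m^*$, $$\begin{aligned}\mathbf R(z)&=\mathbf R_\infty(z)+\frac1z\mathbf R_0(z)+\mathcal C(z) +\sum_{m=1}^{M_1}\Big[\frac{\operatorname{Res}_{z_m}\mathbf R^+}{z-z_m}+\frac{\operatorname{Res}_{z_m^*}\mathbf R^-}{z-z_m^*}\Big] +\sum_{m=1}^{M_2}\Big[\frac{\operatorname{Res}_{\theta_m}\mathbf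 R^+}{z-\theta_m}+\frac{\operatorname{Res}_{\theta_m^*}\mathbf R^-}{z-\theta_m^*}\Big]\\ &\quad+\sum_{m=1}^{M_2}\Big[\frac{\operatorname{Res}_{q_0^2/\theta_m^*}\mathbf R^+}{z-q_0^2/\theta_m^*}+\frac{\operatorname{Res}_{q_0^2/\theta_m}\mathbf R^-}{z-q_0^2/\theta_m}\Big].\end{aligned}$$ Further, for all $z\in\mathbb D^-$ (in particular $z=\theta_n^*,z_n^*$), $$\mathbf R_1^-(z)=\begin{pmatrix}1\\ \mathbf q_- /z\end{pmatrix}+\mathcal C_1(z)+\sum_{m=1}^{M_1}\frac{\mathrm iC_m\widehat\rho(z_m)\mathbf R_3^+(z_m)}{z-z_m}-\sum_{m=1}^{M_2}\frac{F_m\mathbf R_2^+(\theta_m)}{z-\theta_m};$$ for all $z\in\mathbb D^+$ (in particular $z=z_n,q_0^2/\theta_n^*$), $$\mathbf R_3^+(z)=\begin{pmatrix}-\mathrm iq_0/z\\ -\mathrm i\mathbf q_- /q_0\end{pmatrix}+\mathcal C_3(z)+\sum_{m=1}^{M_1}\frac{\mathrm i\bar C_m\widehat\rho(z_m^*)\mathbf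 R_1^-(z_m^*)}{z-z_m^*}+\sum_{m=1}^{M_2}\frac{\check F_m\mathbf R_2^-(q_0^2/\theta_m)}{z-q_0^2/\theta_m};$$ and for $n=1,\dots,M_2$, with $w_n=q_0^2/\theta_n$, $$\mathbf R_2^+(\theta_n)=\begin{pmatrix}0\\ q_0\mathbf q_+^\perp/\mathbf q_+^\dagger\mathbf q_-\end{pmatrix}+\mathcal C_2(\theta_n)+\sum_{m=1}^{M_2}\frac{\mathrm i\bar F_m\widehat\rho(\theta_m^*)\mathbf R_1^-(\theta_m^*)}{\theta_n-\theta_m^*}-\sum_{m=1}^{M_2}\frac{\mathrm i\hat F_m\widehat\rho(q_0^2/\theta_m^*)\mathbf R_3^+(q_0^2/\theta_m^*)}{\theta_n-q_0^2/\theta_m^*},$$ $$\mathbf R_2^-(w_n)=\begin{pmatrix}0\\ \mathbf q_-^\perp/q_0\end{pmatrix}+\mathcal C_2(w_n)+\sum_{m=1}^{M_2}\frac{\mathrm i\bar F_m\widehat\rho(\theta_m^*)\mathbf R_1^-(\theta_m^*)}{w_n-\theta_m^*}-\sum_{m=1}^{M_2}\frac{\mathrm i\hat F_m\widehat\rho(q_0^2/\theta_m^*)\mathbf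 R_3^+(q_0^2/\theta_m^*)}{w_n-q_0^2/\theta_m^*}.$$ -/

import Mathlib

open Complex Filter Topology MeasureTheory Asymptotics

noncomputable section

namespace HirotaRH

/-- `3 × 3` complex matrices. -/
abbrev Mat3 : Type := Matrix (Fin 3) (Fin 3) ℂ

/-- Two-component complex vectors with the Hermitian norm;
`inner ℂ v w` is `v† w`, conjugate linear in `v`. -/
abbrev Vec2 : Type := EuclideanSpace ℂ (Fin 2)

/-- The open upper half-plane. -/
def DPlus : Set ℂ := {z | 0 < z.im}

/-- The open lower half-plane. -/
def DMinus : Set ℂ := {z | z.im < 0}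

/-- The closed upper half-plane. -/
def DPlusClosed : Set ℂ := {z | 0 ≤ z.im}

/-- The closed lower half-plane. -/
def DMinusClosed : Set ℂ := {z | z.im ≤ 0}

/-- `v^⊥ = (v₂, -v₁)†`. -/
def perp (v : Vec2) : Vec2 :=
  WithLp.toLp 2 ![(starRingEnd ℂ) (v 1), -(starRingEnd ℂ) (v 0)]

/-! ### Uniformization variable and phases -/

/-- `k(z) = (z + q₀²/z)/2`. -/
def kfun (q₀ : ℝ) (z : ℂ) : ℂ := (z + (q₀ : ℂ) ^ 2 / z) / 2

/-- `λ(z) = (z - q₀²/z)/2`. -/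
def lam (q₀ : ℝ) (z : ℂ) : ℂ := (z - (q₀ : ℂ) ^ 2 / z) / 2

/-- `ρ̂(z) = z²/(z² - q₀²)`. -/
def rho (q₀ : ℝ) (z : ℂ) : ℂ := z ^ 2 / (z ^ 2 - (q₀ : ℂ) ^ 2)

/-- `δ₁(z; x, t) = λ x + 2 λ [k + σ (3 k² - λ²)] t`. -/
def delta₁ (q₀ σ x t : ℝ) (z : ℂ) : ℂ :=
  lam q₀ z * x
    + 2 * lam q₀ z * (kfun q₀ z + σ * (3 * kfun q₀ z ^ 2 - lam q₀ z ^ 2)) * t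

/-- `δ₂(z; x, t) = -k x - (λ² + k² + 4 σ k³) t`. -/
def delta₂ (q₀ σ x t : ℝ) (z : ℂ) : ℂ :=
  -(kfun q₀ z) * x
    - (lam q₀ z ^ 2 + kfun q₀ z ^ 2 + 4 * σ * kfun q₀ z ^ 3) * t

/-- The diagonal of `Δ = diag(δ₁, δ₂, -δ₁)`. -/
def Delta (q₀ σ x t : ℝ) (z : ℂ) : Fin 3 → ℂ :=
  ![delta₁ q₀ σ x t z, delta₂ q₀ σ x t z, -delta₁ q₀ σ x t z]

/-- The matrix `exp(i Δ(z))`. -/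
def expDelta (q₀ σ x t : ℝ) (z : ℂ) : Mat3 :=
  Matrix.diagonal fun j => exp (I * Delta q₀ σ x t z j)

/-- The matrix `exp(-i Δ(z))`. -/
def expNegDelta (q₀ σ x t : ℝ) (z : ℂ) : Mat3 :=
  Matrix.diagonal fun j => exp (-(I * Delta q₀ σ x t z j))

/-! ### Spectral data -/

/-- The data of the Riemann-Hilbert problem: reflection coefficients `β₁, β₂` on the real line,
discrete eigenvalues `z_m` on the circle of radius `q₀` and `θ_m` inside it, in the upper
half-plane (with their mirror images under `z ↦ z*` and `z ↦ q₀²/z`), and the `(x,t)`-independent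
factors of the norming constants, e.g. `C⁰_m = c_m / h₁₁'(z_m)`. No symmetry between the norming
constants is imposed. -/
structure SpectralData (q₀ : ℝ) (M₁ M₂ : ℕ) where
  β₁ : ℝ → ℂ
  β₂ : ℝ → ℂ
  z : Fin M₁ → ℂ
  θ : Fin M₂ → ℂ
  z_im_pos : ∀ m, 0 < (z m).im
  z_norm : ∀ m, ‖z m‖ = q₀
  z_injective : Function.Injective z
  θ_im_pos : ∀ m, 0 < (θ m).im
  θ_norm_lt : ∀ m, ‖θ m‖ < q₀
  θ_injective : Function.Injective θ
  C₀ : Fin M₁ → ℂ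
  Cbar₀ : Fin M₁ → ℂ
  F₀ : Fin M₂ → ℂ
  Fbar₀ : Fin M₂ → ℂ
  Fcheck₀ : Fin M₂ → ℂ
  Fhat₀ : Fin M₂ → ℂ

namespace SpectralData

variable {q₀ : ℝ} {M₁ M₂ : ℕ} (d : SpectralData q₀ M₁ M₂)

/-- `z_m*`. -/
def zc (m : Fin M₁) : ℂ := (starRingEnd ℂ) (d.z m)

/-- `θ_m*`. -/
def θc (m : Fin M₂) : ℂ := (starRingEnd ℂ) (d.θ m)

/-- `q₀²/θ_m`. -/
def θi (m : Fin M₂) : ℂ := (q₀ : ℂ) ^ 2 / d.θ m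

/-- `q₀²/θ_m*`. -/
def θic (m : Fin M₂) : ℂ := (q₀ : ℂ) ^ 2 / (starRingEnd ℂ) (d.θ m)

/-- `C_m`. -/
def C (σ x t : ℝ) (m : Fin M₁) : ℂ :=
  d.C₀ m * exp (-2 * I * delta₁ q₀ σ x t (d.z m))

/-- `C̄_m`. -/
def Cbar (σ x t : ℝ) (m : Fin M₁) : ℂ :=
  d.Cbar₀ m * exp (2 * I * delta₁ q₀ σ x t (d.zc m))

/-- `F_m`. -/
def F (σ x t : ℝ) (m : Fin M₂) : ℂ :=
  d.F₀ m * exp (I * (delta₂ q₀ σ x t (d.θ m) - delta₁ q₀ σ x t (d.θ m)))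

/-- `F̄_m`. -/
def Fbar (σ x t : ℝ) (m : Fin M₂) : ℂ :=
  d.Fbar₀ m * exp (I * (delta₁ q₀ σ x t (d.θc m) - delta₂ q₀ σ x t (d.θc m)))

/-- `F̌_m`. -/
def Fcheck (σ x t : ℝ) (m : Fin M₂) : ℂ :=
  d.Fcheck₀ m * exp (I * (delta₂ q₀ σ x t (d.θ m) - delta₁ q₀ σ x t (d.θ m)))

/-- `F̂_m`. -/
def Fhat (σ x t : ℝ) (m : Fin M₂) : ℂ :=
  d.Fhat₀ m * exp (I * (delta₁ q₀ σ x t (d.θc m) - delta₂ q₀ σ x t (d.θc m)))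

/-- The whole discrete spectrum. -/
def spectrum : Set ℂ :=
  Set.range d.z ∪ Set.range d.zc ∪ Set.range d.θ ∪ Set.range d.θc
    ∪ Set.range d.θi ∪ Set.range d.θic

/-- Poles of the `j`-th column of `R⁺`: `z_m, θ_m` for the first, `q₀²/θ_m*` for the second. -/
def polesPlus : Fin 3 → Set ℂ :=
  ![Set.range d.z ∪ Set.range d.θ, Set.range d.θic, ∅]

/-- Poles of the `j`-th column of `R⁻`: `θ_m*` for the second, `z_m*, q₀²/θ_m` for the third. -/
def polesMinus : Fin 3 → Set ℂ :=
  ![∅, Set.range d.θc, Set.range d.zc ∪ Set.range d.θi]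

/-- The matrix `K(z)`, `z` real, that defines the jump; `b̂(z) = b(q₀²/z)`. -/
def K (s : ℝ) : Mat3 :=
  let z : ℂ := s
  let q : ℂ := q₀
  let ρ : ℂ := rho q₀ z
  let b₁ : ℂ := d.β₁ s
  let b₂ : ℂ := d.β₂ s
  let h₁ : ℂ := d.β₁ (q₀ ^ 2 / s)
  let h₂ : ℂ := d.β₂ (q₀ ^ 2 / s)
  let b₁c : ℂ := (starRingEnd ℂ) b₁
  let b₂c : ℂ := (starRingEnd ℂ) b₂
  let h₁c : ℂ := (starRingEnd ℂ) h₁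
  let h₂c : ℂ := (starRingEnd ℂ) h₂
  !![I * ρ * (1 + b₁c * h₁c) - I * (b₂ * b₂c) + z * b₁c * b₂c * h₂ / q,
      z * h₁c * h₂c / q - I * b₂c - I * z ^ 2 * b₂c * (h₂ * h₂c) / (q ^ 2 * ρ),
      I * z * h₂ * b₂c / (q * ρ) - h₁c;
    b₂ + I * z / q * b₁c * h₂,
      1 + z ^ 2 / (q ^ 2 * ρ) * (h₂ * h₂c),
      -(z / (q * ρ) * h₂);
    -b₁c,
      I * z / (q * ρ) * h₂c,
      1 / (I * ρ)]

/-- `L = K - I`. -/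
def L (s : ℝ) : Mat3 := d.K s - 1

end SpectralData

/-! ### Leading coefficients at infinity and at the origin -/

/-- `R_∞⁺`. -/
def RinfPlus (q₀ : ℝ) (qp qm : Vec2) : Mat3 :=
  !![I, 0, 0;
    0, q₀ * perp qp 0 / inner ℂ qp qm, qm 0 / (I * q₀);
    0, q₀ * perp qp 1 / inner ℂ qp qm, qm 1 / (I * q₀)]

/-- `R_∞⁻`. -/
def RinfMinus (q₀ : ℝ) (qp qm : Vec2) : Mat3 :=
  !![1, 0, 0;
    0, perp qm 0 / q₀, q₀ * qp 0 / inner ℂ qm qp;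
    0, perp qm 1 / q₀, q₀ * qp 1 / inner ℂ qm qp]

/-- `R₀⁺`. -/
def RzeroPlus (q₀ : ℝ) : Mat3 :=
  !![0, 0, -I * q₀;
    0, 0, 0;
    0, 0, 0]

/-- `R₀⁻`. -/
def RzeroMinus (qm : Vec2) : Mat3 :=
  !![0, 0, 0;
    qm 0, 0, 0;
    qm 1, 0, 0]

/-! ### Residues -/

/-- `f` is meromorphic at `p` with at most a simple pole there. -/
def AtMostSimplePole (f : ℂ → ℂ) (p : ℂ) : Prop :=
  MeromorphicAt f p ∧ -1 ≤ meromorphicOrderAt f p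

/-- The residue at `p` of a function with at most a simple pole at `p`: the limit of
`(z - p) f(z)`. It is only used where `AtMostSimplePole f p` holds. -/
def residue (f : ℂ → ℂ) (p : ℂ) : ℂ :=
  limUnder (𝓝[≠] p) fun z => (z - p) * f z

/-- Entrywise residue of a matrix function. -/
def matResidue (R : ℂ → Mat3) (p : ℂ) : Mat3 :=
  Matrix.of fun i j => residue (fun z => R z i j) p

/-! ### The Riemann-Hilbert problem -/

/-- `(R⁺, R⁻)`, given on the closed upper and lower half-planes (with boundary values on the real
line), solves the Riemann-Hilbert problem at `(x,t)`. In the residue conditions only those columns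
of `R^±(p)` that are analytic at `p` are multiplied by a nonzero entry. -/
structure IsRHSolution {q₀ : ℝ} {M₁ M₂ : ℕ} (σ x t : ℝ) (qp qm : Vec2)
    (d : SpectralData q₀ M₁ M₂) (Rp Rm : ℂ → Mat3) : Prop where
  /-- Each column is analytic in the open half-plane off its poles. -/
  analytic_plus : ∀ i j, DifferentiableOn ℂ (fun z => Rp z i j) (DPlus \ d.polesPlus j)
  analytic_minus : ∀ i j, DifferentiableOn ℂ (fun z => Rm z i j) (DMinus \ d.polesMinus j)
  /-- The poles are at most simple. -/
  simple_plus : ∀ i j, ∀ p ∈ d.polesPlus j, AtMostSimplePole (fun z => Rp z i j) p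
  simple_minus : ∀ i j, ∀ p ∈ d.polesMinus j, AtMostSimplePole (fun z => Rm z i j) p
  /-- Continuous boundary values on the real line off `0, ±q₀`. -/
  boundary_plus : ∀ i j, ContinuousOn (fun z => Rp z i j)
    (DPlusClosed \ (d.polesPlus j ∪ {0, (q₀ : ℂ), -(q₀ : ℂ)}))
  boundary_minus : ∀ i j, ContinuousOn (fun z => Rm z i j)
    (DMinusClosed \ (d.polesMinus j ∪ {0, (q₀ : ℂ), -(q₀ : ℂ)}))
  /-- The jump condition. -/
  jump : ∀ s : ℝ, s ≠ 0 → s ≠ q₀ → s ≠ -q₀ →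
    Rp s = Rm s * expDelta q₀ σ x t s * d.K s * expNegDelta q₀ σ x t s
  /-- `R^± = R_∞^± + O(1/z)` at infinity. -/
  infty_plus : ∀ i j, (fun z => Rp z i j - RinfPlus q₀ qp qm i j)
    =O[Bornology.cobounded ℂ ⊓ 𝓟 DPlus] fun z => z⁻¹
  infty_minus : ∀ i j, (fun z => Rm z i j - RinfMinus q₀ qp qm i j)
    =O[Bornology.cobounded ℂ ⊓ 𝓟 DMinus] fun z => z⁻¹
  /-- `R^± = R₀^±/z + O(1)` at the origin. -/
  zero_plus : ∀ i j, (fun z => Rp z i j - z⁻¹ * RzeroPlus q₀ i j)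
    =O[𝓝[DPlus] 0] fun _ => (1 : ℂ)
  zero_minus : ∀ i j, (fun z => Rm z i j - z⁻¹ * RzeroMinus qm i j)
    =O[𝓝[DMinus] 0] fun _ => (1 : ℂ)
  /-- `R^±` stay finite at the branch points `±q₀`. -/
  branch_plus : ∀ i j, ∀ b ∈ ({(q₀ : ℂ), -(q₀ : ℂ)} : Set ℂ),
    (fun z => Rp z i j) =O[𝓝[DPlus] b] fun _ => (1 : ℂ)
  branch_minus : ∀ i j, ∀ b ∈ ({(q₀ : ℂ), -(q₀ : ℂ)} : Set ℂ),
    (fun z => Rm z i j) =O[𝓝[DMinus] b] fun _ => (1 : ℂ)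
  /-- The residue conditions. -/
  res_z : ∀ m, matResidue Rp (d.z m) = Rp (d.z m) *
    !![0, 0, 0; 0, 0, 0; I * d.C σ x t m * rho q₀ (d.z m), 0, 0]
  res_zc : ∀ m, matResidue Rm (d.zc m) = Rm (d.zc m) *
    !![0, 0, I * d.Cbar σ x t m * rho q₀ (d.zc m); 0, 0, 0; 0, 0, 0]
  res_θ : ∀ m, matResidue Rp (d.θ m) = Rp (d.θ m) *
    !![0, 0, 0; -d.F σ x t m, 0, 0; 0, 0, 0]
  res_θc : ∀ m, matResidue Rm (d.θc m) = Rm (d.θc m) *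
    !![0, I * d.Fbar σ x t m * rho q₀ (d.θc m), 0; 0, 0, 0; 0, 0, 0]
  res_θi : ∀ m, matResidue Rm (d.θi m) = Rm (d.θi m) *
    !![0, 0, 0; 0, 0, d.Fcheck σ x t m; 0, 0, 0]
  res_θic : ∀ m, matResidue Rp (d.θic m) = Rp (d.θic m) *
    !![0, 0, 0; 0, 0, 0; 0, -(I * d.Fhat σ x t m * rho q₀ (d.θic m)), 0]

/-! ### The terms of the solution formula -/

/-- The object that equals `P` in the upper and `N` in the lower half-plane. -/
def sectional {α : Type*} (P N : α) (z : ℂ) : α := if 0 < z.im then P else N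

/-- The density
`R_∞^∇ + R₀^∇/ζ + R⁻(ζ) e^{iΔ(ζ)} L(ζ) e^{-iΔ(ζ)}` with `R^∇ = R⁻ - R⁺`. -/
def density {q₀ : ℝ} {M₁ M₂ : ℕ} (σ x t : ℝ) (qp qm : Vec2)
    (d : SpectralData q₀ M₁ M₂) (Rm : ℂ → Mat3) (s : ℝ) : Mat3 :=
  (RinfMinus q₀ qp qm - RinfPlus q₀ qp qm)
    + (s : ℂ)⁻¹ • (RzeroMinus qm - RzeroPlus q₀)
    + Rm s * expDelta q₀ σ x t s * d.L s * expNegDelta q₀ σ x t s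

/-- `(2πi)⁻¹ ∫_ℝ A(ζ) dζ/(ζ - z)`, entrywise. -/
def cauchyIntegral (A : ℝ → Mat3) (z : ℂ) : Mat3 :=
  Matrix.of fun i j => (2 * Real.pi * I)⁻¹ * ∫ s : ℝ, A s i j / ((s : ℂ) - z)

end HirotaRH

end

/-!
Subtracting from `R^±` its leading terms at infinity and at the origin and the principal parts at
all points of the discrete spectrum leaves functions that are analytic in the two half-planes,
bounded near the real line and `O(1/z)` at infinity. The same principal parts are subtracted on
both sides, so the difference of the boundary values from above and below is the density of the
Cauchy integral. By Cauchy's theorem on horizontal lines and dominated convergence, the Cauchy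
integral of the boundary values from above reproduces the function in the upper half-plane and
vanishes in the lower one; from below the roles are exchanged, with a sign. Together this is the
solution formula. Each residue condition puts a principal part into a single column, so the formula
for a column also holds at those points of the spectrum where that column has no pole.
-/

noncomputable section

namespace HirotaRH

open Bornology

theorem isOpen_DPlus : IsOpen DPlus := isOpen_lt continuous_const continuous_im

theorem isOpen_DMinus : IsOpen DMinus := isOpen_lt continuous_im continuous_const

theorem frontier_DPlus_subset : frontier DPlus ⊆ Set.range ((↑) : ℝ → ℂ) := by
  intro z hz
  rw [DPlus, frontier_setOfPred_lt_im] at hz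
  exact ⟨z.re, Complex.ext rfl hz.symm⟩

theorem frontier_DMinus_subset : frontier DMinus ⊆ Set.range ((↑) : ℝ → ℂ) := by
  intro z hz
  rw [DMinus, frontier_setOfPred_im_lt] at hz
  exact ⟨z.re, Complex.ext rfl hz.symm⟩

theorem ofReal_ne_of_im_ne_zero {z : ℂ} (hz : z.im ≠ 0) (s : ℝ) : (s : ℂ) ≠ z := by
  rintro rfl
  exact hz (ofReal_im s)

theorem ofReal_add_mul_I_mem_DPlus (s : ℝ) {y : ℝ} (hy : 0 < y) : (s : ℂ) + y * I ∈ DPlus := by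
  simpa [DPlus] using hy

theorem norm_ofReal_add_mul_I_sq (s y : ℝ) : ‖(s : ℂ) + y * I‖ ^ 2 = s ^ 2 + y ^ 2 := by
  rw [← normSq_eq_norm_sq, normSq_add_mul_I]

theorem tendsto_inv_sub {p c : ℂ} (h : c ≠ p) (U : Set ℂ) :
    Tendsto (fun z : ℂ => (z - p)⁻¹) (𝓝[U] c) (𝓝 (c - p)⁻¹) :=
  ((continuous_sub_right p).continuousAt.inv₀ (sub_ne_zero.2 h)).continuousWithinAt

theorem isBigO_inv_sub (p : ℂ) : (fun z : ℂ => (z - p)⁻¹) =O[cobounded ℂ] fun z => z⁻¹ := by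
  have hequiv : (fun z : ℂ => z - p) ~[cobounded ℂ] fun z => z :=
    IsEquivalent.refl.sub_isLittleO (isLittleO_const_id_cobounded p)
  exact hequiv.inv.isBigO

theorem isBigO_inv_one_add_norm_inv : (fun z : ℂ => z⁻¹) =O[cobounded ℂ] fun z => (1 + ‖z‖)⁻¹ := by
  refine IsBigO.of_bound 2 ?_
  filter_upwards [hasBasis_cobounded_norm.mem_of_mem (i := 1) trivial] with z (hz : 1 ≤ ‖z‖)
  rw [norm_inv, norm_inv, Real.norm_of_nonneg (by positivity), ← div_eq_mul_inv,
    inv_le_comm₀ (by positivity) (by positivity), inv_div]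
  linarith

theorem isBigO_principal_of_forall_nhdsWithin {X E F : Type*} [TopologicalSpace X]
    [Norm E] [SeminormedAddCommGroup F] {f : X → E} {g : X → F} {U : Set X}
    (hloc : ∀ x, f =O[𝓝[U] x] g) (hinf : f =O[cocompact X ⊓ 𝓟 U] g) : f =O[𝓟 U] g := by
  obtain ⟨c, -, K, hK, hc⟩ := hinf.exists_mem_basis (hasBasis_cocompact.inf_principal U)
  have hcompact : f =O[𝓟 (K ∩ U)] g := by
    refine hK.induction_on (p := fun s => f =O[𝓟 (s ∩ U)] g) (by simp)
      (fun s t hst h => h.mono (principal_mono.2 (Set.inter_subset_inter_left U hst)))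
      (fun s t hs ht => ?_) fun x _ => ?_
    · rw [Set.union_inter_distrib_right, ← sup_principal]
      exact hs.sup ht
    · obtain ⟨c, -, t, ht, hct⟩ :=
        (hloc x).exists_mem_basis ((𝓝 x).basis_sets.inf_principal U)
      exact ⟨t, mem_nhdsWithin_of_mem_nhds ht, IsBigO.of_bound c (eventually_principal.2 hct)⟩
  rw [← Set.inter_union_compl U K, ← sup_principal, Set.inter_comm, Set.inter_comm U]
  exact hcompact.sup (IsBigO.of_bound c (eventually_principal.2 hc))

section Decay

variable {E : Type*} [NormedAddCommGroup E]

theorem continuous_horizontal {f : ℂ → E} (hf : ContinuousOn f DPlus) {y : ℝ} (hy : 0 < y) :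
    Continuous fun s : ℝ => f (s + y * I) :=
  hf.comp_continuous (by fun_prop) fun s => ofReal_add_mul_I_mem_DPlus s hy

theorem norm_horizontal_le {f : ℂ → E} {C : ℝ} (hC : 0 ≤ C)
    (hf : ∀ z ∈ DPlus, ‖f z‖ ≤ C * (1 + ‖z‖ ^ 2)⁻¹) (s : ℝ) {y : ℝ} (hy : 0 < y) :
    ‖f (s + y * I)‖ ≤ C * (1 + s ^ 2)⁻¹ := by
  refine (hf _ (ofReal_add_mul_I_mem_DPlus s hy)).trans ?_
  rw [norm_ofReal_add_mul_I_sq]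
  gcongr
  exact le_add_of_nonneg_right (sq_nonneg y)

variable [NormedSpace ℂ E]

/-- Analytic functions on `U`, a half-plane in practice, to which Cauchy's theorem applies up to
the real line: they are `O((1 + |z|)⁻¹)`, and almost everywhere on the real line the value of `F`
is its limit from `U`. -/
structure HasCauchyDecay (U : Set ℂ) (F : ℂ → E) : Prop where
  differentiableOn : DifferentiableOn ℂ F U
  isBigO : F =O[𝓟 U] fun z => (1 + ‖z‖)⁻¹
  tendsto_boundary : ∀ᵐ s : ℝ, Tendsto F (𝓝[U] (s : ℂ)) (𝓝 (F s))

theorem HasCauchyDecay.of_isBigO {U : Set ℂ} {F : ℂ → E}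
    (hU : frontier U ⊆ Set.range ((↑) : ℝ → ℂ)) (hd : DifferentiableOn ℂ F U)
    (hloc : ∀ s : ℝ, F =O[𝓝[U] (s : ℂ)] fun _ => (1 : ℂ))
    (hinf : F =O[cobounded ℂ ⊓ 𝓟 U] fun z => z⁻¹)
    (hbd : ∀ᵐ s : ℝ, Tendsto F (𝓝[U] (s : ℂ)) (𝓝 (F s))) : HasCauchyDecay U F where
  differentiableOn := hd
  isBigO := by
    refine isBigO_principal_of_forall_nhdsWithin (fun z => ?_) ?_
    · have hone : (fun _ => (1 : ℂ)) =O[𝓝[U] z] fun z => (1 + ‖z‖)⁻¹ := by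
        have hcont : ContinuousWithinAt (fun z : ℂ => 1 + ‖z‖) U z := by fun_prop
        simpa using (hcont.isBigO_one ℂ).inv_rev
          (.of_forall fun z h => absurd h (by positivity))
      refine IsBigO.trans ?_ hone
      by_cases hzU : z ∈ U
      · exact (hd.continuousOn z hzU).isBigO_one ℂ
      by_cases hzcl : z ∈ closure U
      · obtain ⟨s, rfl⟩ := hU ⟨hzcl, fun h => hzU (interior_subset h)⟩
        exact hloc s
      · rw [notMem_closure_iff_nhdsWithin_eq_bot.1 hzcl]
        exact IsBigO.of_bound 0 eventually_bot
    · rw [← Metric.cobounded_eq_cocompact]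
      exact hinf.trans (isBigO_inv_one_add_norm_inv.mono inf_le_left)
  tendsto_boundary := hbd

/-! ### Cauchy's theorem in the upper half-plane -/

theorem norm_intervalIntegral_horizontal_le {f : ℂ → E} (hf : DifferentiableOn ℂ f DPlus)
    {ε R M : ℝ} (hε : 0 < ε) (hR : 0 < R) (hM : ∀ z ∈ DPlus, R ≤ ‖z‖ → ‖f z‖ ≤ M) :
    ‖∫ s in (-R)..R, f (s + ε * I)‖ ≤ 4 * M * R := by
  have hM' : ∀ s y : ℝ, 0 < y → R ^ 2 ≤ s ^ 2 + y ^ 2 → ‖f (s + y * I)‖ ≤ M := fun s y hy h => by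
    rw [← norm_ofReal_add_mul_I_sq] at h
    exact hM _ (ofReal_add_mul_I_mem_DPlus s hy) ((sq_le_sq₀ hR.le (norm_nonneg _)).1 h)
  have htop : ‖∫ s in (-R)..R, f (s + (ε + R : ℝ) * I)‖ ≤ M * |R - -R| :=
    intervalIntegral.norm_integral_le_of_norm_le_const fun s _ =>
      hM' s (ε + R) (by positivity) (by nlinarith [sq_nonneg s])
  have hside : ∀ a : ℝ, a ^ 2 = R ^ 2 →
      ‖I • ∫ y in ε..(ε + R), f (a + y * I)‖ ≤ M * |ε + R - ε| := fun a ha => by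
    rw [norm_smul, norm_I, one_mul]
    refine intervalIntegral.norm_integral_le_of_norm_le_const fun y hy => ?_
    rw [Set.uIoc_of_le (by linarith)] at hy
    exact hM' a y (hε.trans hy.1) (by nlinarith [sq_nonneg y])
  have hrect : ∫ s in (-R)..R, f (s + ε * I) =
      (∫ s in (-R)..R, f (s + (ε + R : ℝ) * I)) - (I • ∫ y in ε..(ε + R), f (R + y * I))
        + I • ∫ y in ε..(ε + R), f ((-R : ℝ) + y * I) := by
    have h := integral_boundary_rect_eq_zero_of_differentiableOn f
      ((-R : ℝ) + ε * I) (R + (ε + R : ℝ) * I) (hf.mono fun z hz => by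
        have him := hz.2
        simp only [add_im, ofReal_im, mul_im, ofReal_re, I_im, mul_one, I_re, mul_zero, add_zero,
          zero_add, Set.mem_preimage] at him
        rw [Set.uIcc_of_le (by linarith)] at him
        exact hε.trans_le him.1)
    simp only [add_im, ofReal_im, mul_im, ofReal_re, I_im, mul_one, I_re, mul_zero, add_zero,
      zero_add, add_re, mul_re, sub_zero] at h
    rw [← sub_eq_zero, ← h]
    module
  calc ‖∫ s in (-R)..R, f (s + ε * I)‖ ≤ M * |R - -R| + M * |ε + R - ε| + M * |ε + R - ε| := by
        rw [hrect]
        exact (norm_add_le _ _).trans (add_le_add ((norm_sub_le _ _).trans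
          (add_le_add htop (hside R rfl))) (hside (-R) (neg_sq R)))
    _ = 4 * M * R := by
        rw [sub_neg_eq_add, add_sub_cancel_left, abs_of_pos hR, abs_of_pos (by positivity)]
        ring

theorem integral_horizontal_eq_zero {f : ℂ → E} {C : ℝ} (hC : 0 ≤ C)
    (hf : DifferentiableOn ℂ f DPlus) (hfC : ∀ z ∈ DPlus, ‖f z‖ ≤ C * (1 + ‖z‖ ^ 2)⁻¹)
    {y : ℝ} (hy : 0 < y) : ∫ s : ℝ, f (s + y * I) = 0 := by
  have hint : Integrable fun s : ℝ => f (s + y * I) :=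
    (integrable_inv_one_add_sq.const_mul C).mono'
      (continuous_horizontal hf.continuousOn hy).aestronglyMeasurable
      (ae_of_all _ fun s => norm_horizontal_le hC hfC s hy)
  have hlim : Tendsto (fun R : ℝ => ∫ s in (-R)..R, f (s + y * I)) atTop (𝓝 0) := by
    have hbound : Tendsto (fun R : ℝ => 4 * C * R⁻¹) atTop (𝓝 0) := by
      simpa using tendsto_inv_atTop_zero.const_mul (4 * C)
    refine squeeze_zero_norm' ?_ hbound
    filter_upwards [eventually_gt_atTop 0] with R hR
    calc ‖∫ s in (-R)..R, f (s + y * I)‖ ≤ 4 * (C * (R ^ 2)⁻¹) * R :=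
          norm_intervalIntegral_horizontal_le hf hy hR fun z hz hRz => (hfC z hz).trans (by
            gcongr
            exact (pow_le_pow_left₀ hR.le hRz 2).trans (le_add_of_nonneg_left zero_le_one))
      _ = 4 * C * R⁻¹ := by field_simp
  exact tendsto_nhds_unique
    (intervalIntegral_tendsto_integral hint tendsto_neg_atTop_atBot tendsto_id) hlim

theorem integrable_and_integral_boundary_eq_zero {f : ℂ → E} (hf : DifferentiableOn ℂ f DPlus)
    (hO : f =O[𝓟 DPlus] fun z => (1 + ‖z‖ ^ 2)⁻¹)
    (hbd : ∀ᵐ s : ℝ, Tendsto f (𝓝[DPlus] (s : ℂ)) (𝓝 (f s))) :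
    (Integrable fun s : ℝ => f s) ∧ ∫ s : ℝ, f s = 0 := by
  obtain ⟨C, hC, hfC⟩ : ∃ C, 0 ≤ C ∧ ∀ z ∈ DPlus, ‖f z‖ ≤ C * (1 + ‖z‖ ^ 2)⁻¹ := by
    obtain ⟨C, hC, hOC⟩ := hO.exists_nonneg
    refine ⟨C, hC, fun z hz => (eventually_principal.1 hOC.bound z hz).trans_eq ?_⟩
    rw [Real.norm_of_nonneg (by positivity)]
  obtain ⟨y, -, hy, hy0⟩ := exists_seq_strictAnti_tendsto (0 : ℝ)
  have hmeas : ∀ n, AEStronglyMeasurable (fun s : ℝ => f (s + y n * I)) volume := fun n =>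
    (continuous_horizontal hf.continuousOn (hy n)).aestronglyMeasurable
  have hlim : ∀ᵐ s : ℝ, Tendsto (fun n => f (s + y n * I)) atTop (𝓝 (f s)) := by
    filter_upwards [hbd] with s hs
    have hpath : Tendsto (fun n => (s : ℂ) + y n * I) atTop (𝓝 s) := by
      simpa using (((continuous_ofReal.tendsto 0).comp hy0).mul_const I).const_add (s : ℂ)
    exact hs.comp (tendsto_nhdsWithin_iff.2
      ⟨hpath, .of_forall fun n => ofReal_add_mul_I_mem_DPlus s (hy n)⟩)
  have hdom := integrable_inv_one_add_sq.const_mul C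
  refine ⟨hdom.mono' (aestronglyMeasurable_of_tendsto_ae atTop hmeas hlim) ?_, ?_⟩
  · filter_upwards [hlim] with s hs
    exact le_of_tendsto hs.norm (.of_forall fun n => norm_horizontal_le hC hfC s (hy n))
  · refine tendsto_nhds_unique (tendsto_integral_of_dominated_convergence _ hmeas hdom
      (fun n => ae_of_all _ fun s => norm_horizontal_le hC hfC s (hy n)) hlim) ?_
    simp only [integral_horizontal_eq_zero hC hf hfC (hy _), tendsto_const_nhds]

/-! ### The Cauchy transform of boundary values -/

theorem HasCauchyDecay.integrable_and_integral_smul_eq_zero {k : ℂ → ℂ} {F : ℂ → E}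
    (hk : HasCauchyDecay DPlus k) (hF : HasCauchyDecay DPlus F) :
    (Integrable fun s : ℝ => k s • F s) ∧ ∫ s : ℝ, k s • F s = 0 := by
  refine integrable_and_integral_boundary_eq_zero (f := fun z => k z • F z)
    (hk.differentiableOn.smul hF.differentiableOn) ?_ ?_
  · refine (hk.isBigO.smul hF.isBigO).trans (IsBigO.of_bound 1 (.of_forall fun z => ?_))
    rw [one_mul, smul_eq_mul, ← mul_inv, Real.norm_of_nonneg (by positivity),
      Real.norm_of_nonneg (by positivity)]
    gcongr
    nlinarith [norm_nonneg z]
  · filter_upwards [hk.tendsto_boundary, hF.tendsto_boundary] with s hks hFs using hks.smul hFs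

theorem hasCauchyDecay_inv_sub {p : ℂ} (hp : p.im < 0) :
    HasCauchyDecay DPlus fun z => (z - p)⁻¹ := by
  refine .of_isBigO frontier_DPlus_subset ?_ (fun s => ?_) ((isBigO_inv_sub p).mono inf_le_left)
    (ae_of_all _ fun s => tendsto_inv_sub (ofReal_ne_of_im_ne_zero hp.ne s) DPlus)
  · refine DifferentiableOn.inv (by fun_prop) fun z hz => sub_ne_zero.2 ?_
    rintro rfl
    exact lt_asymm hp hz
  · exact (tendsto_inv_sub (ofReal_ne_of_im_ne_zero hp.ne s) DPlus).isBigO_one ℂ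

theorem HasCauchyDecay.isBigO_one {U : Set ℂ} {F : ℂ → E} (hF : HasCauchyDecay U F) :
    F =O[𝓟 U] fun _ => (1 : ℂ) :=
  hF.isBigO.trans <| IsBigO.of_bound 1 <| .of_forall fun z => by
    rw [Real.norm_of_nonneg (by positivity), norm_one, mul_one]
    exact inv_le_one_of_one_le₀ (le_add_of_nonneg_right (norm_nonneg z))

theorem hasCauchyDecay_dslope [CompleteSpace E] {F : ℂ → E} (hF : HasCauchyDecay DPlus F) {z : ℂ}
    (hz : 0 < z.im) : HasCauchyDecay DPlus (dslope F z) := by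
  have hslope : ∀ {w}, w ≠ z → (w - z)⁻¹ • (F w - F z) = dslope F z w := fun hw => by
    rw [dslope_of_ne _ hw, slope_def_module]
  have hne : ∀ s : ℝ, ∀ᶠ w in 𝓝[DPlus] (s : ℂ), w ≠ z := fun s =>
    (eventually_ne_nhds (ofReal_ne_of_im_ne_zero hz.ne' s)).filter_mono nhdsWithin_le_nhds
  have hinv : ∀ s : ℝ, Tendsto (fun w => (w - z)⁻¹) (𝓝[DPlus] (s : ℂ)) (𝓝 ((s : ℂ) - z)⁻¹) :=
    fun s => tendsto_inv_sub (ofReal_ne_of_im_ne_zero hz.ne' s) DPlus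
  have hbounded : (fun w => F w - F z) =O[𝓟 DPlus] fun _ => (1 : ℂ) :=
    hF.isBigO_one.sub (isBigO_const_const _ one_ne_zero _)
  refine .of_isBigO frontier_DPlus_subset
    ((differentiableOn_dslope (isOpen_DPlus.mem_nhds hz)).2 hF.differentiableOn)
    (fun s => ?_) ?_ ?_
  · refine (((hinv s).isBigO_one ℂ).smul (hbounded.mono inf_le_right)).congr' ?_ (by simp)
    filter_upwards [hne s] with w hw using hslope hw
  · refine (((isBigO_inv_sub z).mono inf_le_left).smul (hbounded.mono inf_le_right)).congr' ?_
      (by simp)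
    filter_upwards [(eventually_ne_cobounded z).filter_mono inf_le_left] with w hw
      using hslope hw
  · filter_upwards [hF.tendsto_boundary] with s hs
    rw [← hslope (ofReal_ne_of_im_ne_zero hz.ne' s)]
    refine ((hinv s).smul (hs.sub_const (F z))).congr' ?_
    filter_upwards [hne s] with w hw using hslope hw

theorem integral_inv_mul_inv_conj {z : ℂ} (hz : 0 < z.im) :
    ∫ s : ℝ, ((s : ℂ) - z)⁻¹ * ((s : ℂ) - (starRingEnd ℂ) z)⁻¹ = Real.pi / z.im := by
  have hkernel : ∀ s : ℝ, ((s : ℂ) - z)⁻¹ * ((s : ℂ) - (starRingEnd ℂ) z)⁻¹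
      = ((z.im ^ 2)⁻¹ * (1 + ((s - z.re) / z.im) ^ 2)⁻¹ : ℝ) := fun s => by
    rw [← conj_ofReal s, ← map_sub, conj_ofReal, ← mul_inv, mul_conj, normSq_apply, ← ofReal_inv,
      ← mul_inv, sub_re, sub_im, ofReal_re, ofReal_im]
    congr 2
    field_simp
    ring
  simp only [hkernel]
  rw [integral_complex_ofReal, integral_const_mul,
    integral_sub_right_eq_self (f := fun x : ℝ ↦ (1 + (x / z.im) ^ 2)⁻¹),
    Measure.integral_comp_div (g := fun x : ℝ ↦ (1 + x ^ 2)⁻¹), integral_univ_inv_one_add_sq,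
    smul_eq_mul, abs_of_pos hz]
  push_cast
  field_simp

-- The kernel `(s - z)⁻¹` alone is not integrable, so the Cauchy integral of the constant `F z`
-- would diverge; the second factor, analytic in the upper half-plane, restores convergence.
theorem HasCauchyDecay.integrable_and_integral_poisson [CompleteSpace E] {F : ℂ → E}
    (hF : HasCauchyDecay DPlus F) {z : ℂ} (hz : 0 < z.im) :
    (Integrable fun s : ℝ => (((s : ℂ) - z)⁻¹ * (s - (starRingEnd ℂ) z)⁻¹) • F s) ∧
      ∫ s : ℝ, (((s : ℂ) - z)⁻¹ * (s - (starRingEnd ℂ) z)⁻¹) • F s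
        = (Real.pi / z.im : ℂ) • F z := by
  have hkernel : Integrable fun s : ℝ => ((s : ℂ) - z)⁻¹ * (s - (starRingEnd ℂ) z)⁻¹ :=
    .of_integral_ne_zero <| by
      rw [integral_inv_mul_inv_conj hz]
      exact div_ne_zero (ofReal_ne_zero.2 Real.pi_ne_zero) (ofReal_ne_zero.2 hz.ne')
  obtain ⟨hint, hzero⟩ := (hasCauchyDecay_inv_sub (p := (starRingEnd ℂ) z)
    (by simpa using hz)).integrable_and_integral_smul_eq_zero (hasCauchyDecay_dslope hF hz)
  have hsplit : (fun s : ℝ => (((s : ℂ) - z)⁻¹ * (s - (starRingEnd ℂ) z)⁻¹) • F s) = fun s : ℝ =>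
      ((s : ℂ) - (starRingEnd ℂ) z)⁻¹ • dslope F z s
        + (((s : ℂ) - z)⁻¹ * (s - (starRingEnd ℂ) z)⁻¹) • F z := by
    funext s
    rw [dslope_of_ne _ (ofReal_ne_of_im_ne_zero hz.ne' s), slope_def_module]
    module
  rw [hsplit]
  refine ⟨hint.add (hkernel.smul_const _), ?_⟩
  rw [integral_add hint (hkernel.smul_const _), hzero, integral_smul_const,
    integral_inv_mul_inv_conj hz, zero_add]

/-- The Cauchy transform `(2πi)⁻¹ ∫ A(s) ds / (s - z)` of a density on the real line. -/
def cauchyTransform (A : ℝ → E) (z : ℂ) : E :=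
  (2 * Real.pi * I : ℂ)⁻¹ • ∫ s : ℝ, ((s : ℂ) - z)⁻¹ • A s

theorem HasCauchyDecay.cauchyTransform_of_im_neg {F : ℂ → E} (hF : HasCauchyDecay DPlus F) {z : ℂ}
    (hz : z.im < 0) : (Integrable fun s : ℝ => ((s : ℂ) - z)⁻¹ • F s) ∧
      cauchyTransform (fun s => F s) z = 0 := by
  obtain ⟨hint, hzero⟩ := (hasCauchyDecay_inv_sub hz).integrable_and_integral_smul_eq_zero hF
  exact ⟨hint, by rw [cauchyTransform, hzero, smul_zero]⟩

theorem HasCauchyDecay.cauchyTransform_of_im_pos [CompleteSpace E] {F : ℂ → E}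
    (hF : HasCauchyDecay DPlus F) {z : ℂ} (hz : 0 < z.im) :
    (Integrable fun s : ℝ => ((s : ℂ) - z)⁻¹ • F s) ∧ cauchyTransform (fun s => F s) z = F z := by
  obtain ⟨hconj, hconj0⟩ := (hasCauchyDecay_inv_sub (p := (starRingEnd ℂ) z)
    (by simpa using hz)).integrable_and_integral_smul_eq_zero hF
  obtain ⟨hpoisson, hvalue⟩ := hF.integrable_and_integral_poisson hz
  have hsplit : (fun s : ℝ => ((s : ℂ) - z)⁻¹ • F s) = fun s : ℝ =>
      ((s : ℂ) - (starRingEnd ℂ) z)⁻¹ • F s + (z - (starRingEnd ℂ) z) •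
        (((s : ℂ) - z)⁻¹ * (s - (starRingEnd ℂ) z)⁻¹) • F s := by
    funext s
    have hs : (s : ℂ) - z ≠ 0 := sub_ne_zero.2 (ofReal_ne_of_im_ne_zero hz.ne' s)
    have hs' : (s : ℂ) - (starRingEnd ℂ) z ≠ 0 :=
      sub_ne_zero.2 (ofReal_ne_of_im_ne_zero (by simpa using hz.ne') s)
    rw [smul_smul, ← add_smul]
    congr 1
    field_simp
    ring
  have hsmul := hpoisson.fun_smul (z - (starRingEnd ℂ) z)
  refine ⟨hsplit ▸ hconj.add hsmul, ?_⟩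
  have him : (z.im : ℂ) ≠ 0 := ofReal_ne_zero.2 hz.ne'
  rw [cauchyTransform, hsplit, integral_add hconj hsmul, hconj0, integral_smul, hvalue,
    zero_add, smul_smul, smul_smul, sub_conj]
  convert one_smul ℂ (F z)
  push_cast
  field_simp

theorem HasCauchyDecay.comp_neg {F : ℂ → E} (hF : HasCauchyDecay DMinus F) :
    HasCauchyDecay DPlus fun z => F (-z) := by
  have hmaps : Set.MapsTo Neg.neg DPlus DMinus := fun z hz => by simpa [DPlus, DMinus] using hz
  refine ⟨hF.differentiableOn.comp (by fun_prop) hmaps, ?_, ?_⟩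
  · simpa [Function.comp_def] using hF.isBigO.comp_tendsto (tendsto_principal_principal.2 hmaps)
  · filter_upwards [(Measure.measurePreserving_neg volume).quasiMeasurePreserving.ae
      hF.tendsto_boundary] with s hs
    have hneg : Tendsto Neg.neg (𝓝[DPlus] (s : ℂ)) (𝓝[DMinus] ((-s : ℝ) : ℂ)) := by
      rw [ofReal_neg]
      exact (continuous_neg.tendsto (s : ℂ)).inf (tendsto_principal_principal.2 hmaps)
    simpa [Function.comp_def] using hs.comp hneg

theorem inv_sub_smul_comp_neg (A : ℝ → E) (z : ℂ) (s : ℝ) :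
    ((s : ℂ) - -z)⁻¹ • A (-s) = -(fun u : ℝ => ((u : ℂ) - z)⁻¹ • A u) (-s) := by
  simp only [ofReal_neg]
  rw [← neg_smul, ← inv_neg]
  congr 2
  ring

theorem integrable_inv_sub_smul_of_comp_neg {A : ℝ → E} {z : ℂ}
    (h : Integrable fun s : ℝ => ((s : ℂ) - -z)⁻¹ • A (-s)) :
    Integrable fun s : ℝ => ((s : ℂ) - z)⁻¹ • A s := by
  simp only [inv_sub_smul_comp_neg A z] at h
  simpa using h.comp_neg.neg

theorem cauchyTransform_comp_neg (A : ℝ → E) (z : ℂ) :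
    cauchyTransform (fun s => A (-s)) (-z) = -cauchyTransform A z := by
  simp only [cauchyTransform, inv_sub_smul_comp_neg A z]
  rw [integral_neg, integral_neg_eq_self (fun u : ℝ => ((u : ℂ) - z)⁻¹ • A u), smul_neg]

theorem HasCauchyDecay.cauchyTransform_plus [CompleteSpace E] {F : ℂ → E}
    (hF : HasCauchyDecay DPlus F) {z : ℂ} (hz : z.im ≠ 0) :
    (Integrable fun s : ℝ => ((s : ℂ) - z)⁻¹ • F s) ∧
      cauchyTransform (fun s => F s) z = sectional (F z) 0 z := by
  rcases hz.lt_or_gt with h | h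
  · rw [sectional, if_neg h.not_gt]
    exact hF.cauchyTransform_of_im_neg h
  · rw [sectional, if_pos h]
    exact hF.cauchyTransform_of_im_pos h

theorem HasCauchyDecay.cauchyTransform_minus [CompleteSpace E] {G : ℂ → E}
    (hG : HasCauchyDecay DMinus G) {z : ℂ} (hz : z.im ≠ 0) :
    (Integrable fun s : ℝ => ((s : ℂ) - z)⁻¹ • G s) ∧
      cauchyTransform (fun s => G s) z = sectional 0 (-G z) z := by
  obtain ⟨hint, hvalue⟩ := hG.comp_neg.cauchyTransform_plus (z := -z) (by simpa using hz)
  simp only [← ofReal_neg] at hint hvalue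
  refine ⟨integrable_inv_sub_smul_of_comp_neg hint, ?_⟩
  rw [← neg_neg (cauchyTransform _ z), ← cauchyTransform_comp_neg, hvalue, neg_neg]
  rcases hz.lt_or_gt with h | h
  · simp [sectional, h, h.not_gt]
  · simp [sectional, h, h.not_gt]

theorem HasCauchyDecay.plemelj [CompleteSpace E] {F G : ℂ → E} (hF : HasCauchyDecay DPlus F)
    (hG : HasCauchyDecay DMinus G) {z : ℂ} (hz : z.im ≠ 0) :
    (Integrable fun s : ℝ => ((s : ℂ) - z)⁻¹ • (F s - G s)) ∧
      cauchyTransform (fun s => F s - G s) z = sectional (F z) (G z) z := by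
  obtain ⟨hFint, hFz⟩ := hF.cauchyTransform_plus hz
  obtain ⟨hGint, hGz⟩ := hG.cauchyTransform_minus hz
  simp only [smul_sub]
  refine ⟨hFint.sub hGint, ?_⟩
  calc cauchyTransform (fun s => F s - G s) z
      = cauchyTransform (fun s => F s) z - cauchyTransform (fun s => G s) z := by
        simp only [cauchyTransform, smul_sub]
        rw [integral_sub hFint hGint, smul_sub]
    _ = sectional (F z) (G z) z := by
        rw [hFz, hGz, sectional, sectional, sectional]
        split_ifs <;> simp

end Decay

/-! ### Functions with simple poles -/

section PoleExpansion

variable {ι E : Type*} [NormedAddCommGroup E] [NormedSpace ℂ E]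

theorem exists_differentiableOn_eqOn_compl [CompleteSpace E] {U S : Set ℂ} (hU : IsOpen U)
    (hS : S.Finite) {g : ℂ → E} (hg : DifferentiableOn ℂ g (U \ S))
    (hlim : ∀ c ∈ U ∩ S, Tendsto (fun z => (z - c) • g z) (𝓝[≠] c) (𝓝 0)) :
    ∃ F : ℂ → E, DifferentiableOn ℂ F U ∧ Set.EqOn F g Sᶜ := by
  classical
  refine ⟨fun z => if z ∈ S then limUnder (𝓝[≠] z) g else g z, fun c hc => ?_,
    fun z hz => if_neg hz⟩
  by_cases hcS : c ∈ S
  swap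
  · have hnhds : U \ S ∈ 𝓝 c := (hU.sdiff hS.isClosed).mem_nhds ⟨hc, hcS⟩
    refine ((hg.differentiableAt hnhds).congr_of_eventuallyEq ?_).differentiableWithinAt
    filter_upwards [hnhds] with z hz using if_neg hz.2
  have hnhds : U \ (S \ {c}) ∈ 𝓝 c := (hU.sdiff hS.sdiff.isClosed).mem_nhds ⟨hc, by simp⟩
  have hd : DifferentiableOn ℂ g ((U \ (S \ {c})) \ {c}) :=
    hg.mono fun z hz => ⟨hz.1.1, fun hzS => hz.1.2 ⟨hzS, hz.2⟩⟩
  have hone : (fun z => (z - c) • (g z - g c)) =o[𝓝[≠] c] fun _ => (1 : ℂ) := by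
    refine (isLittleO_one_iff ℂ).2 ?_
    have hconst : ContinuousAt (fun z => (z - c) • g c) c := by fun_prop
    simpa [smul_sub] using (hlim c ⟨hc, hcS⟩).sub (hconst.tendsto.mono_left nhdsWithin_le_nhds)
  have ho : (fun z => g z - g c) =o[𝓝[≠] c] fun z => (z - c)⁻¹ := by
    refine ((isBigO_refl (fun z => (z - c)⁻¹) _).smul_isLittleO hone).congr' ?_ (by simp)
    filter_upwards [self_mem_nhdsWithin] with z hz
    exact inv_smul_smul₀ (sub_ne_zero.2 hz) _
  refine ((differentiableOn_update_limUnder_of_isLittleO hnhds hd ho).differentiableAt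
    hnhds |>.congr_of_eventuallyEq ?_).differentiableWithinAt
  filter_upwards [hnhds] with z hz
  rcases eq_or_ne z c with rfl | hzc
  · simp [hcS]
  · rw [Function.update_of_ne hzc, if_neg fun hzS => hz.2 ⟨hzS, hzc⟩]

/-- `f` has on `U` at most simple poles, at points of `T`, with residues `r k` at the points `p k`;
it is `a + O(1/z)` at infinity, `b/z + O(1)` at the origin and bounded near every other real point,
and almost every real number is a point of continuity from `U`. The family `p` may contain points
outside `T`, where `r` has to vanish, and points outside `U`, where `r` is arbitrary. -/
structure HasPoleExpansion (U T : Set ℂ) (p : ι → ℂ) (r : ι → E) (a b : E) (f : ℂ → E) :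
    Prop where
  subset_range : T ⊆ Set.range p
  differentiableOn : DifferentiableOn ℂ f (U \ T)
  tendsto_residue : ∀ k, p k ∈ U ∩ T →
    Tendsto (fun z => (z - p k) • f z) (𝓝[≠] p k) (𝓝 (r k))
  residue_eq_zero : ∀ k, p k ∈ U \ T → r k = 0
  isBigO_infty : (fun z => f z - a) =O[cobounded ℂ ⊓ 𝓟 U] fun z => z⁻¹
  isBigO_real : ∀ s : ℝ, (fun z => f z - z⁻¹ • b) =O[𝓝[U] (s : ℂ)] fun _ => (1 : ℂ)
  tendsto_boundary : ∀ᵐ s : ℝ, Tendsto f (𝓝[U] (s : ℂ)) (𝓝 (f s))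

theorem HasPoleExpansion.of_continuousOn [Finite ι] {U V T B : Set ℂ} {p : ι → ℂ} {r : ι → E}
    {a b : E} {f : ℂ → E} (hUV : U ⊆ V) (hV : Set.range ((↑) : ℝ → ℂ) ⊆ V)
    (hT : T ⊆ Set.range p) (him : ∀ k, (p k).im ≠ 0) (hB : B.Finite)
    (hd : DifferentiableOn ℂ f (U \ T))
    (hres : ∀ k, p k ∈ U ∩ T → Tendsto (fun z => (z - p k) • f z) (𝓝[≠] p k) (𝓝 (r k)))
    (hres_zero : ∀ k, p k ∈ U \ T → r k = 0)
    (hinf : (fun z => f z - a) =O[cobounded ℂ ⊓ 𝓟 U] fun z => z⁻¹)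
    (hzero : (fun z => f z - z⁻¹ • b) =O[𝓝[U] 0] fun _ => (1 : ℂ))
    (hbranch : ∀ c ∈ B, f =O[𝓝[U] c] fun _ => (1 : ℂ))
    (hcont : ContinuousOn f (V \ (T ∪ insert 0 B))) : HasPoleExpansion U T p r a b f := by
  have hlim : ∀ s : ℝ, (s : ℂ) ∉ insert 0 B → Tendsto f (𝓝[U] (s : ℂ)) (𝓝 (f s)) := fun s hs => by
    have hsT : (s : ℂ) ∉ T := fun h => by
      obtain ⟨k, hk⟩ := hT h
      exact ofReal_ne_of_im_ne_zero (him k) s hk.symm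
    have hs' : (s : ℂ) ∉ T ∪ insert 0 B := by simp_all
    have hclosed : IsClosed (T ∪ insert 0 B) :=
      (((Set.finite_range p).subset hT).union (hB.insert 0)).isClosed
    refine (hcont s ⟨hV ⟨s, rfl⟩, hs'⟩).mono_of_mem_nhdsWithin ?_
    filter_upwards [self_mem_nhdsWithin,
      mem_nhdsWithin_of_mem_nhds (hclosed.isOpen_compl.mem_nhds hs')] with z hzU hz
    exact ⟨hUV hzU, hz⟩
  refine ⟨hT, hd, hres, hres_zero, hinf, fun s => ?_, ?_⟩
  · rcases eq_or_ne s 0 with rfl | hs0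
    · simpa using hzero
    have hf : f =O[𝓝[U] (s : ℂ)] fun _ => (1 : ℂ) := by
      by_cases hsB : (s : ℂ) ∈ B
      · exact hbranch s hsB
      · exact (hlim s (by simp [hs0, hsB])).isBigO_one ℂ
    have hinv : Tendsto (fun z : ℂ => z⁻¹) (𝓝[U] (s : ℂ)) (𝓝 (s : ℂ)⁻¹) := by
      simpa using tendsto_inv_sub (ofReal_ne_zero.2 hs0) U
    exact hf.sub ((hinv.smul_const b).isBigO_one ℂ)
  · have hnull : volume ((↑) ⁻¹' insert 0 B : Set ℝ) = 0 :=
      ((hB.insert 0).preimage ofReal_injective.injOn).measure_zero _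
    filter_upwards [compl_mem_ae_iff.2 hnull] with s hs using hlim s hs

end PoleExpansion

/-! ### Subtraction of principal parts -/

section PrincipalPart

variable {ι E : Type*} [Fintype ι]

/-- The sum of the principal parts of simple poles at the points `p k` with residues `r k`. -/
def principalPart [AddCommMonoid E] [Module ℂ E] (p : ι → ℂ) (r : ι → E) (z : ℂ) : E :=
  ∑ k, (z - p k)⁻¹ • r k

variable [NormedAddCommGroup E] [NormedSpace ℂ E]

theorem differentiableOn_principalPart {p : ι → ℂ} {r : ι → E} {U : Set ℂ}
    (h : ∀ k, p k ∈ U → r k = 0) : DifferentiableOn ℂ (principalPart p r) U := by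
  refine DifferentiableOn.fun_sum fun k _ => ?_
  by_cases hk : r k = 0
  · simp only [hk, smul_zero]
    exact differentiableOn_const 0
  · refine (DifferentiableOn.inv (by fun_prop) fun z hz => sub_ne_zero.2 ?_).smul_const _
    rintro rfl
    exact hk (h k hz)

theorem tendsto_principalPart {p : ι → ℂ} {c : ℂ} (h : ∀ k, c ≠ p k) (r : ι → E) (U : Set ℂ) :
    Tendsto (principalPart p r) (𝓝[U] c) (𝓝 (principalPart p r c)) :=
  tendsto_finsetSum _ fun k _ => (tendsto_inv_sub (h k) U).smul_const (r k)

theorem isBigO_principalPart (p : ι → ℂ) (r : ι → E) :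
    principalPart p r =O[cobounded ℂ] fun z => z⁻¹ :=
  IsBigO.fun_sum fun k _ => by
    simpa using (isBigO_inv_sub (p k)).smul (isBigO_const_const (r k) (one_ne_zero (α := ℂ)) _)

theorem tendsto_sub_smul_principalPart {p : ι → ℂ} (hp : Function.Injective p) (r : ι → E) (k : ι) :
    Tendsto (fun z => (z - p k) • principalPart p r z) (𝓝[≠] p k) (𝓝 (r k)) := by
  classical
  have hterm : ∀ l, Tendsto (fun z => (z - p k) • (z - p l)⁻¹ • r l) (𝓝[≠] p k)
      (𝓝 (if k = l then r l else 0)) := fun l => by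
    split_ifs with hkl
    · subst hkl
      refine tendsto_const_nhds.congr' ?_
      filter_upwards [self_mem_nhdsWithin] with z hz
      rw [smul_inv_smul₀ (sub_ne_zero.2 hz)]
    · have hsub : Tendsto (fun z => z - p k) (𝓝[≠] p k) (𝓝 0) := by
        have hcont : ContinuousAt (fun z => z - p k) (p k) := by fun_prop
        simpa using hcont.tendsto.mono_left nhdsWithin_le_nhds
      simpa using hsub.smul ((tendsto_inv_sub (hp.ne hkl) _).smul_const (r l))
  simpa [principalPart, Finset.smul_sum] using tendsto_finsetSum Finset.univ fun l _ => hterm l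

namespace HasPoleExpansion

variable {U T : Set ℂ} {p : ι → ℂ} {r : ι → E} {a b : E} {f : ℂ → E}

theorem exists_differentiableOn [CompleteSpace E] (h : HasPoleExpansion U T p r a b f)
    (hU : IsOpen U) (h0 : 0 ∉ U) (hp : Function.Injective p) :
    ∃ F : ℂ → E, DifferentiableOn ℂ F U ∧
      Set.EqOn F (fun z => f z - a - z⁻¹ • b - principalPart p r z) Tᶜ := by
  have hne : ∀ z ∈ U, z ≠ 0 := fun z hz => ne_of_mem_of_not_mem hz h0
  have hleading : DifferentiableOn ℂ (fun z => z⁻¹ • b) U :=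
    (differentiableOn_id.inv hne).smul_const b
  refine exists_differentiableOn_eqOn_compl hU ((Set.finite_range p).subset h.subset_range)
    (((h.differentiableOn.sub_const a).sub (hleading.mono Set.sdiff_subset)).sub
      (differentiableOn_principalPart h.residue_eq_zero)) ?_
  rintro c ⟨hcU, hcT⟩
  obtain ⟨k, rfl⟩ := h.subset_range hcT
  have hreg : Tendsto (fun z => (z - p k) • (a + z⁻¹ • b)) (𝓝[≠] p k) (𝓝 0) := by
    have hcont : ContinuousAt (fun z => (z - p k) • (a + z⁻¹ • b)) (p k) := by
      have := hne _ hcU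
      fun_prop (disch := assumption)
    simpa using hcont.tendsto.mono_left nhdsWithin_le_nhds
  have hlim := ((h.tendsto_residue k ⟨hcU, hcT⟩).sub hreg).sub
    (tendsto_sub_smul_principalPart hp r k)
  rw [sub_zero, sub_self] at hlim
  refine hlim.congr fun z => ?_
  rw [← smul_sub, ← smul_sub, ← sub_sub (f z)]

theorem exists_hasCauchyDecay [CompleteSpace E] (h : HasPoleExpansion U T p r a b f)
    (hU : IsOpen U) (hfrontier : frontier U ⊆ Set.range ((↑) : ℝ → ℂ)) (h0 : 0 ∉ U)
    (hp : Function.Injective p) (him : ∀ k, (p k).im ≠ 0) :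
    ∃ F : ℂ → E, HasCauchyDecay U F ∧
      Set.EqOn F (fun z => f z - a - z⁻¹ • b - principalPart p r z) Tᶜ := by
  obtain ⟨F, hd, hF⟩ := h.exists_differentiableOn hU h0 hp
  have hreal : ∀ (s : ℝ) k, (s : ℂ) ≠ p k := fun s k => ofReal_ne_of_im_ne_zero (him k) s
  have hT : T.Finite := (Set.finite_range p).subset h.subset_range
  have hrealT : ∀ s : ℝ, (s : ℂ) ∈ Tᶜ := fun s hs => by
    obtain ⟨k, hk⟩ := h.subset_range hs
    exact hreal s k hk.symm
  have hnear : ∀ s : ℝ, (fun z => f z - a - z⁻¹ • b - principalPart p r z) =ᶠ[𝓝[U] (s : ℂ)] F :=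
    fun s => by
      filter_upwards [mem_nhdsWithin_of_mem_nhds (hT.isClosed.isOpen_compl.mem_nhds (hrealT s))]
        with z hz using (hF hz).symm
  have hfar : (fun z => f z - a - z⁻¹ • b - principalPart p r z) =ᶠ[cobounded ℂ ⊓ 𝓟 U] F := by
    filter_upwards [mem_inf_of_left (isBounded_def.1 hT.isBounded)] with z hz using (hF hz).symm
  refine ⟨F, .of_isBigO hfrontier hd (fun s => ?_) ?_ ?_, hF⟩
  · refine IsBigO.congr' ?_ (hnear s) EventuallyEq.rfl
    refine IsBigO.sub ?_ ((tendsto_principalPart (hreal s) r U).isBigO_one ℂ)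
    simpa only [sub_right_comm] using (h.isBigO_real s).sub (isBigO_const_const a one_ne_zero _)
  · refine IsBigO.congr' ?_ hfar EventuallyEq.rfl
    refine (h.isBigO_infty.sub ?_).sub ((isBigO_principalPart p r).mono inf_le_left)
    simpa using (isBigO_refl (fun z : ℂ => z⁻¹) _).smul
      (isBigO_const_const b (one_ne_zero (α := ℂ)) _)
  · filter_upwards [h.tendsto_boundary, Measure.ae_ne volume 0] with s hs hs0
    rw [hF (hrealT s)]
    refine Tendsto.congr' (hnear s) (((hs.sub_const a).sub ?_).sub
      (tendsto_principalPart (hreal s) r U))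
    simpa using (tendsto_inv_sub (ofReal_ne_zero.2 hs0) U).smul_const b

theorem exists_hasCauchyDecay_ae_eq_sub [CompleteSpace E] {S : Set ℂ} {a' b' : E} {g : ℂ → E}
    {A : ℝ → E}
    (hf : HasPoleExpansion DPlus T p r a b f) (hg : HasPoleExpansion DMinus S p r a' b' g)
    (hp : Function.Injective p) (him : ∀ k, (p k).im ≠ 0)
    (hA : ∀ᵐ s : ℝ, A s = (a' - a) + (s : ℂ)⁻¹ • (b' - b) + (f s - g s)) :
    ∃ F G : ℂ → E, HasCauchyDecay DPlus F ∧ HasCauchyDecay DMinus G ∧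
      Set.EqOn F (fun z => f z - a - z⁻¹ • b - principalPart p r z) Tᶜ ∧
      Set.EqOn G (fun z => g z - a' - z⁻¹ • b' - principalPart p r z) Sᶜ ∧
      A =ᵐ[volume] fun s => F s - G s := by
  obtain ⟨F, hF, hFf⟩ := hf.exists_hasCauchyDecay isOpen_DPlus frontier_DPlus_subset
    (by simp [DPlus]) hp him
  obtain ⟨G, hG, hGg⟩ := hg.exists_hasCauchyDecay isOpen_DMinus frontier_DMinus_subset
    (by simp [DMinus]) hp him
  refine ⟨F, G, hF, hG, hFf, hGg, ?_⟩
  have hreal : ∀ {V : Set ℂ}, V ⊆ Set.range p → ∀ s : ℝ, (s : ℂ) ∈ Vᶜ := fun hV s hs => by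
    obtain ⟨k, hk⟩ := hV hs
    exact ofReal_ne_of_im_ne_zero (him k) s hk.symm
  filter_upwards [hA] with s hs
  rw [hs, hFf (hreal hf.subset_range s), hGg (hreal hg.subset_range s)]
  module

theorem plemelj [CompleteSpace E] {S : Set ℂ} {a' b' : E} {g : ℂ → E} {A : ℝ → E}
    (hf : HasPoleExpansion DPlus T p r a b f) (hg : HasPoleExpansion DMinus S p r a' b' g)
    (hp : Function.Injective p) (him : ∀ k, (p k).im ≠ 0)
    (hA : ∀ᵐ s : ℝ, A s = (a' - a) + (s : ℂ)⁻¹ • (b' - b) + (f s - g s)) {z : ℂ}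
    (hz : z.im ≠ 0) :
    (Integrable fun s : ℝ => ((s : ℂ) - z)⁻¹ • A s) ∧
      (0 < z.im → z ∉ T → f z = a + z⁻¹ • b + cauchyTransform A z + principalPart p r z) ∧
      (z.im < 0 → z ∉ S → g z = a' + z⁻¹ • b' + cauchyTransform A z + principalPart p r z) := by
  obtain ⟨F, G, hF, hG, hFf, hGg, hAFG⟩ := exists_hasCauchyDecay_ae_eq_sub hf hg hp him hA
  obtain ⟨hint, hvalue⟩ := hF.plemelj hG hz
  have hcongr : (fun s : ℝ => ((s : ℂ) - z)⁻¹ • (F s - G s)) =ᵐ[volume]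
      fun s : ℝ => ((s : ℂ) - z)⁻¹ • A s := by
    filter_upwards [hAFG] with s hs
    rw [hs]
  have hC : cauchyTransform A z = sectional (F z) (G z) z := by
    rw [← hvalue, cauchyTransform, ← integral_congr_ae hcongr, cauchyTransform]
  refine ⟨hint.congr hcongr, fun h hzT => ?_, fun h hzS => ?_⟩
  · rw [hC, sectional, if_pos h, hFf hzT]
    module
  · rw [hC, sectional, if_neg h.not_gt, hGg hzS]
    module

end HasPoleExpansion

end PrincipalPart

/-! ### Residues and the discrete spectrum -/

theorem AtMostSimplePole.tendsto_residue {f : ℂ → ℂ} {p : ℂ} (h : AtMostSimplePole f p) :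
    Tendsto (fun z => (z - p) * f z) (𝓝[≠] p) (𝓝 (residue f p)) := by
  have hsub : MeromorphicAt (fun z : ℂ => z - p) p := by fun_prop
  have horder : 0 ≤ meromorphicOrderAt ((fun z => z - p) * f) p := by
    rw [meromorphicOrderAt_mul hsub h.1, meromorphicOrderAt_id_sub_const]
    calc (0 : WithTop ℤ) = 1 + (-1) := rfl
      _ ≤ _ := by gcongr; exact h.2
  obtain ⟨c, hc⟩ := tendsto_nhds_of_meromorphicOrderAt_nonneg (hsub.mul h.1) horder
  exact tendsto_nhds_limUnder ⟨c, hc⟩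

theorem residue_eq_zero_of_continuousAt {f : ℂ → ℂ} {p : ℂ} (h : ContinuousAt f p) :
    residue f p = 0 := by
  have hcont : ContinuousAt (fun z => (z - p) * f z) p := by fun_prop
  exact Tendsto.limUnder_eq (by simpa using hcont.tendsto.mono_left nhdsWithin_le_nhds)

namespace SpectralData

variable {q₀ : ℝ} {M₁ M₂ : ℕ} (d : SpectralData q₀ M₁ M₂)

/-- The family of the points of the discrete spectrum in the upper half-plane. -/
def plusPoint : Fin M₁ ⊕ Fin M₂ ⊕ Fin M₂ → ℂ := Sum.elim d.z (Sum.elim d.θ d.θic)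

/-- The family of the points of the discrete spectrum in the lower half-plane. -/
def minusPoint : Fin M₁ ⊕ Fin M₂ ⊕ Fin M₂ → ℂ := Sum.elim d.zc (Sum.elim d.θc d.θi)

/-- The family of all points of the discrete spectrum. -/
def point : (Fin M₁ ⊕ Fin M₂ ⊕ Fin M₂) ⊕ (Fin M₁ ⊕ Fin M₂ ⊕ Fin M₂) → ℂ :=
  Sum.elim d.plusPoint d.minusPoint

theorem θ_ne_zero (m : Fin M₂) : d.θ m ≠ 0 := fun h => by
  simpa [h] using d.θ_im_pos m

theorem θic_eq_conj_θi (m : Fin M₂) : d.θic m = (starRingEnd ℂ) (d.θi m) := by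
  simp [θic, θi]

theorem minusPoint_eq_conj (k) : d.minusPoint k = (starRingEnd ℂ) (d.plusPoint k) := by
  rcases k with m | m | m
  · rfl
  · rfl
  · simp [minusPoint, plusPoint, θic_eq_conj_θi]

theorem norm_θc_lt (m : Fin M₂) : ‖d.θc m‖ < q₀ := by
  rw [θc, RCLike.norm_conj]
  exact d.θ_norm_lt m

theorem lt_norm_θi (hq₀ : 0 < q₀) (m : Fin M₂) : q₀ < ‖d.θi m‖ := by
  rw [θi, norm_div, norm_pow, norm_real, Real.norm_of_nonneg hq₀.le,
    lt_div_iff₀ (norm_pos_iff.2 (d.θ_ne_zero m)), sq]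
  exact mul_lt_mul_of_pos_left (d.θ_norm_lt m) hq₀

theorem lt_norm_θic (hq₀ : 0 < q₀) (m : Fin M₂) : q₀ < ‖d.θic m‖ := by
  rw [θic_eq_conj_θi, RCLike.norm_conj]
  exact d.lt_norm_θi hq₀ m

theorem θi_im_neg (hq₀ : 0 < q₀) (m : Fin M₂) : (d.θi m).im < 0 := by
  have hθ : 0 < normSq (d.θ m) := normSq_pos.2 (d.θ_ne_zero m)
  rw [θi, div_eq_mul_inv, ← ofReal_pow, im_ofReal_mul, inv_im]
  exact mul_neg_of_pos_of_neg (by positivity)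
    (div_neg_of_neg_of_pos (neg_lt_zero.2 (d.θ_im_pos m)) hθ)

theorem plusPoint_im_pos (hq₀ : 0 < q₀) (k) : 0 < (d.plusPoint k).im := by
  rcases k with m | m | m
  · exact d.z_im_pos m
  · exact d.θ_im_pos m
  · simpa [plusPoint, θic_eq_conj_θi] using d.θi_im_neg hq₀ m

theorem minusPoint_im_neg (hq₀ : 0 < q₀) (k) : (d.minusPoint k).im < 0 := by
  simpa [minusPoint_eq_conj] using d.plusPoint_im_pos hq₀ k

theorem point_im_ne_zero (hq₀ : 0 < q₀) (k) : (d.point k).im ≠ 0 := by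
  rcases k with k | k
  · exact (d.plusPoint_im_pos hq₀ k).ne'
  · exact (d.minusPoint_im_neg hq₀ k).ne

theorem θic_injective (hq₀ : 0 < q₀) : Function.Injective d.θic := fun m n h => by
  have hq : (q₀ : ℂ) ^ 2 ≠ 0 := pow_ne_zero 2 (ofReal_ne_zero.2 hq₀.ne')
  rw [θic, θic, div_eq_mul_inv, div_eq_mul_inv] at h
  exact d.θ_injective ((starRingEnd ℂ).injective (inv_injective (mul_left_cancel₀ hq h)))

theorem plusPoint_injective (hq₀ : 0 < q₀) : Function.Injective d.plusPoint := by
  refine d.z_injective.sumElim (d.θ_injective.sumElim (d.θic_injective hq₀) fun m n h => ?_) ?_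
  · exact ((h ▸ d.θ_norm_lt m).trans (d.lt_norm_θic hq₀ n)).false
  · rintro m (n | n) h
    · exact (d.θ_norm_lt n).ne ((congrArg norm h).symm.trans (d.z_norm m))
    · exact (d.lt_norm_θic hq₀ n).ne' ((congrArg norm h).symm.trans (d.z_norm m))

theorem point_injective (hq₀ : 0 < q₀) : Function.Injective d.point := by
  refine (d.plusPoint_injective hq₀).sumElim (fun k l h => ?_) fun k l h => ?_
  · rw [minusPoint_eq_conj, minusPoint_eq_conj] at h
    exact d.plusPoint_injective hq₀ ((starRingEnd ℂ).injective h)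
  · exact ((h ▸ d.plusPoint_im_pos hq₀ k).trans (d.minusPoint_im_neg hq₀ l)).false

theorem polesPlus_subset (j : Fin 3) : d.polesPlus j ⊆ Set.range d.point := by
  fin_cases j
  · rintro _ (⟨m, rfl⟩ | ⟨m, rfl⟩)
    exacts [⟨.inl (.inl m), rfl⟩, ⟨.inl (.inr (.inl m)), rfl⟩]
  · rintro _ ⟨m, rfl⟩
    exact ⟨.inl (.inr (.inr m)), rfl⟩
  · exact fun _ h => h.elim

theorem polesMinus_subset (j : Fin 3) : d.polesMinus j ⊆ Set.range d.point := by
  fin_cases j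
  · exact fun _ h => h.elim
  · rintro _ ⟨m, rfl⟩
    exact ⟨.inr (.inr (.inl m)), rfl⟩
  · rintro _ (⟨m, rfl⟩ | ⟨m, rfl⟩)
    exacts [⟨.inr (.inl m), rfl⟩, ⟨.inr (.inr (.inr m)), rfl⟩]

theorem range_point_subset_spectrum : Set.range d.point ⊆ d.spectrum := by
  rintro _ ⟨(m | m | m) | (m | m | m), rfl⟩ <;>
    simp [point, plusPoint, minusPoint, spectrum]

theorem θ_notMem_polesPlus_one (hq₀ : 0 < q₀) (n : Fin M₂) : d.θ n ∉ d.polesPlus 1 := by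
  rintro ⟨m, hm⟩
  exact ((hm ▸ d.lt_norm_θic hq₀ m).trans (d.θ_norm_lt n)).false

theorem θi_notMem_polesMinus_one (hq₀ : 0 < q₀) (n : Fin M₂) : d.θi n ∉ d.polesMinus 1 := by
  rintro ⟨m, hm⟩
  exact ((hm ▸ d.norm_θc_lt m).trans (d.lt_norm_θi hq₀ n)).false

end SpectralData

/-! ### Solutions of the Riemann-Hilbert problem -/

theorem cauchyIntegral_apply (A : ℝ → Mat3) (z : ℂ) (i j : Fin 3) :
    cauchyIntegral A z i j = cauchyTransform (fun s => A s i j) z := by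
  simp [cauchyIntegral, cauchyTransform, div_eq_inv_mul]

theorem principalPart_apply {ι : Type*} [Fintype ι] (p : ι → ℂ) (R : ι → Mat3) (z : ℂ)
    (i j : Fin 3) : principalPart p R z i j = principalPart p (fun k => R k i j) z := by
  simp [principalPart, Matrix.sum_apply]

theorem expDelta_mul_expNegDelta (q₀ σ x t : ℝ) (z : ℂ) :
    expDelta q₀ σ x t z * expNegDelta q₀ σ x t z = 1 := by
  simp [expDelta, expNegDelta, Matrix.diagonal_mul_diagonal, ← exp_add]

theorem RinfMinus_add_RzeroMinus_col_zero (q₀ : ℝ) (qp qm : Vec2) (z : ℂ) :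
    (RinfMinus q₀ qp qm + z⁻¹ • RzeroMinus qm).col 0 = ![1, qm 0 / z, qm 1 / z] := by
  ext i
  fin_cases i <;> simp [RinfMinus, RzeroMinus, div_eq_inv_mul]

theorem RinfPlus_add_RzeroPlus_col_one (q₀ : ℝ) (qp qm : Vec2) (z : ℂ) :
    (RinfPlus q₀ qp qm + z⁻¹ • RzeroPlus q₀).col 1 =
      ![0, q₀ * perp qp 0 / inner ℂ qp qm, q₀ * perp qp 1 / inner ℂ qp qm] := by
  ext i
  fin_cases i <;> simp [RinfPlus, RzeroPlus]

theorem RinfMinus_add_RzeroMinus_col_one (q₀ : ℝ) (qp qm : Vec2) (z : ℂ) :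
    (RinfMinus q₀ qp qm + z⁻¹ • RzeroMinus qm).col 1 = ![0, perp qm 0 / q₀, perp qm 1 / q₀] := by
  ext i
  fin_cases i <;> simp [RinfMinus, RzeroMinus]

theorem RinfPlus_add_RzeroPlus_col_two (q₀ : ℝ) (qp qm : Vec2) (z : ℂ) :
    (RinfPlus q₀ qp qm + z⁻¹ • RzeroPlus q₀).col 2 =
      ![-I * q₀ / z, -I * qm 0 / q₀, -I * qm 1 / q₀] := by
  ext i
  fin_cases i <;> simp [RinfPlus, RzeroPlus, div_eq_mul_inv] <;> ring

/-- The family of the residues of `Rp` and `Rm` at the points of the discrete spectrum. -/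
def residues {q₀ : ℝ} {M₁ M₂ : ℕ} (d : SpectralData q₀ M₁ M₂) (Rp Rm : ℂ → Mat3) :
    (Fin M₁ ⊕ Fin M₂ ⊕ Fin M₂) ⊕ (Fin M₁ ⊕ Fin M₂ ⊕ Fin M₂) → Mat3 :=
  Sum.elim (fun k => matResidue Rp (d.plusPoint k)) fun k => matResidue Rm (d.minusPoint k)

theorem principalPart_residues {q₀ : ℝ} {M₁ M₂ : ℕ} (d : SpectralData q₀ M₁ M₂)
    (Rp Rm : ℂ → Mat3) (z : ℂ) :
    principalPart d.point (residues d Rp Rm) z =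
      ∑ m, ((z - d.z m)⁻¹ • matResidue Rp (d.z m) + (z - d.zc m)⁻¹ • matResidue Rm (d.zc m))
      + ∑ m, ((z - d.θ m)⁻¹ • matResidue Rp (d.θ m) + (z - d.θc m)⁻¹ • matResidue Rm (d.θc m))
      + ∑ m, ((z - d.θic m)⁻¹ • matResidue Rp (d.θic m)
          + (z - d.θi m)⁻¹ • matResidue Rm (d.θi m)) := by
  simp only [principalPart, Fintype.sum_sum_type, SpectralData.point, SpectralData.plusPoint,
    SpectralData.minusPoint, residues, Sum.elim_inl, Sum.elim_inr, Finset.sum_add_distrib]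
  abel

namespace IsRHSolution

variable {q₀ σ x t : ℝ} {qp qm : Vec2} {M₁ M₂ : ℕ} {d : SpectralData q₀ M₁ M₂} {Rp Rm : ℂ → Mat3}

theorem hasPoleExpansion_plus (hR : IsRHSolution σ x t qp qm d Rp Rm) (hq₀ : 0 < q₀) (i j : Fin 3) :
    HasPoleExpansion DPlus (d.polesPlus j) d.point (fun k => residues d Rp Rm k i j)
      (RinfPlus q₀ qp qm i j) (RzeroPlus q₀ i j) fun z => Rp z i j := by
  have hopen : IsOpen (DPlus \ d.polesPlus j) :=
    isOpen_DPlus.sdiff ((Set.finite_range _).subset (d.polesPlus_subset j)).isClosed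
  have hmem : ∀ {P : Set ℂ} {k}, d.minusPoint k ∈ DPlus ∩ P → False := fun hk =>
    lt_asymm hk.1 (d.minusPoint_im_neg hq₀ _)
  refine .of_continuousOn (V := DPlusClosed) (B := {(q₀ : ℂ), -(q₀ : ℂ)})
    (fun z (hz : 0 < z.im) => hz.le) ?_ (d.polesPlus_subset j) (d.point_im_ne_zero hq₀)
    (Set.toFinite _) (hR.analytic_plus i j) ?_ ?_ (hR.infty_plus i j) (hR.zero_plus i j)
    (hR.branch_plus i j) (hR.boundary_plus i j)
  · rintro _ ⟨s, rfl⟩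
    exact (ofReal_im s).ge
  · rintro (k | k) hk
    · exact (hR.simple_plus i j _ hk.2).tendsto_residue
    · exact (hmem hk).elim
  · rintro (k | k) hk
    · exact residue_eq_zero_of_continuousAt
        (hR.analytic_plus i j |>.continuousOn.continuousAt (hopen.mem_nhds hk))
    · exact (hmem hk).elim

theorem hasPoleExpansion_minus (hR : IsRHSolution σ x t qp qm d Rp Rm) (hq₀ : 0 < q₀)
    (i j : Fin 3) :
    HasPoleExpansion DMinus (d.polesMinus j) d.point (fun k => residues d Rp Rm k i j)
      (RinfMinus q₀ qp qm i j) (RzeroMinus qm i j) fun z => Rm z i j := by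
  have hopen : IsOpen (DMinus \ d.polesMinus j) :=
    isOpen_DMinus.sdiff ((Set.finite_range _).subset (d.polesMinus_subset j)).isClosed
  have hmem : ∀ {P : Set ℂ} {k}, d.plusPoint k ∈ DMinus ∩ P → False := fun hk =>
    lt_asymm hk.1 (d.plusPoint_im_pos hq₀ _)
  refine .of_continuousOn (V := DMinusClosed) (B := {(q₀ : ℂ), -(q₀ : ℂ)})
    (fun z (hz : z.im < 0) => hz.le) ?_ (d.polesMinus_subset j) (d.point_im_ne_zero hq₀)
    (Set.toFinite _) (hR.analytic_minus i j) ?_ ?_ (hR.infty_minus i j) (hR.zero_minus i j)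
    (hR.branch_minus i j) (hR.boundary_minus i j)
  · rintro _ ⟨s, rfl⟩
    exact (ofReal_im s).le
  · rintro (k | k) hk
    · exact (hmem hk).elim
    · exact (hR.simple_minus i j _ hk.2).tendsto_residue
  · rintro (k | k) hk
    · exact (hmem hk).elim
    · exact residue_eq_zero_of_continuousAt
        (hR.analytic_minus i j |>.continuousOn.continuousAt (hopen.mem_nhds hk))

theorem density_eq (hR : IsRHSolution σ x t qp qm d Rp Rm) {s : ℝ} (h0 : s ≠ 0) (hpos : s ≠ q₀)
    (hneg : s ≠ -q₀) :
    density σ x t qp qm d Rm s = (RinfMinus q₀ qp qm - RinfPlus q₀ qp qm)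
      + (s : ℂ)⁻¹ • (RzeroMinus qm - RzeroPlus q₀) + (Rp s - Rm s) := by
  rw [density, SpectralData.L, Matrix.mul_sub, Matrix.sub_mul, ← hR.jump s h0 hpos hneg, mul_one,
    mul_assoc (Rm s), expDelta_mul_expNegDelta, mul_one]

theorem entry_plemelj (hR : IsRHSolution σ x t qp qm d Rp Rm) (hq₀ : 0 < q₀) (i j : Fin 3) {z : ℂ}
    (hz : z.im ≠ 0) :
    (Integrable fun s : ℝ => ((s : ℂ) - z)⁻¹ • density σ x t qp qm d Rm s i j) ∧
      (0 < z.im → z ∉ d.polesPlus j → Rp z i j = (RinfPlus q₀ qp qm + z⁻¹ • RzeroPlus q₀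
        + cauchyIntegral (density σ x t qp qm d Rm) z
        + principalPart d.point (residues d Rp Rm) z) i j) ∧
      (z.im < 0 → z ∉ d.polesMinus j → Rm z i j = (RinfMinus q₀ qp qm + z⁻¹ • RzeroMinus qm
        + cauchyIntegral (density σ x t qp qm d Rm) z
        + principalPart d.point (residues d Rp Rm) z) i j) := by
  simp only [Matrix.add_apply, Matrix.smul_apply, cauchyIntegral_apply, principalPart_apply]
  refine (hR.hasPoleExpansion_plus hq₀ i j).plemelj (hR.hasPoleExpansion_minus hq₀ i j)
    (d.point_injective hq₀) (d.point_im_ne_zero hq₀) ?_ hz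
  filter_upwards [Measure.ae_ne volume 0, Measure.ae_ne volume q₀, Measure.ae_ne volume (-q₀)]
    with s h0 hpos hneg
  simp [hR.density_eq h0 hpos hneg]

theorem integrable_density_div_sub (hR : IsRHSolution σ x t qp qm d Rp Rm) (hq₀ : 0 < q₀) {z : ℂ}
    (hz : z.im ≠ 0) (i j : Fin 3) :
    Integrable fun s : ℝ => density σ x t qp qm d Rm s i j / ((s : ℂ) - z) := by
  simpa only [smul_eq_mul, div_eq_inv_mul] using (hR.entry_plemelj hq₀ i j hz).1

theorem col_plus (hR : IsRHSolution σ x t qp qm d Rp Rm) (hq₀ : 0 < q₀) {z : ℂ} (hz : 0 < z.im)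
    {j : Fin 3} (hj : z ∉ d.polesPlus j) :
    (Rp z).col j = (RinfPlus q₀ qp qm + z⁻¹ • RzeroPlus q₀).col j
      + (cauchyIntegral (density σ x t qp qm d Rm) z).col j
      + (principalPart d.point (residues d Rp Rm) z).col j :=
  funext fun i => (hR.entry_plemelj hq₀ i j hz.ne').2.1 hz hj

theorem col_minus (hR : IsRHSolution σ x t qp qm d Rp Rm) (hq₀ : 0 < q₀) {z : ℂ} (hz : z.im < 0)
    {j : Fin 3} (hj : z ∉ d.polesMinus j) :
    (Rm z).col j = (RinfMinus q₀ qp qm + z⁻¹ • RzeroMinus qm).col j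
      + (cauchyIntegral (density σ x t qp qm d Rm) z).col j
      + (principalPart d.point (residues d Rp Rm) z).col j :=
  funext fun i => (hR.entry_plemelj hq₀ i j hz.ne).2.2 hz hj

theorem sectional_eq (hR : IsRHSolution σ x t qp qm d Rp Rm) (hq₀ : 0 < q₀) {z : ℂ}
    (hz : z.im ≠ 0) (hsp : z ∉ Set.range d.point) :
    sectional (Rp z) (Rm z) z = sectional (RinfPlus q₀ qp qm) (RinfMinus q₀ qp qm) z
      + z⁻¹ • sectional (RzeroPlus q₀) (RzeroMinus qm) z
      + cauchyIntegral (density σ x t qp qm d Rm) z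
      + principalPart d.point (residues d Rp Rm) z := by
  ext i j
  obtain ⟨-, hplus, hminus⟩ := hR.entry_plemelj hq₀ i j hz
  rcases hz.lt_or_gt with h | h
  · simpa only [sectional, if_neg h.not_gt] using hminus h fun hj => hsp (d.polesMinus_subset j hj)
  · simpa only [sectional, if_pos h] using hplus h fun hj => hsp (d.polesPlus_subset j hj)

theorem principalPart_col_zero (hR : IsRHSolution σ x t qp qm d Rp Rm) (z : ℂ) :
    (principalPart d.point (residues d Rp Rm) z).col 0 =
      ∑ m, (I * d.C σ x t m * rho q₀ (d.z m) / (z - d.z m)) • (Rp (d.z m)).col 2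
        - ∑ m, (d.F σ x t m / (z - d.θ m)) • (Rp (d.θ m)).col 1 := by
  ext i
  simp only [principalPart_residues, hR.res_z, hR.res_zc, hR.res_θ, hR.res_θc, hR.res_θi,
    hR.res_θic]
  simp [Matrix.mul_apply, Fin.sum_univ_three, Matrix.sum_apply, div_eq_inv_mul, sub_eq_add_neg,
    mul_assoc, mul_comm, mul_left_comm]

theorem principalPart_col_one (hR : IsRHSolution σ x t qp qm d Rp Rm) (z : ℂ) :
    (principalPart d.point (residues d Rp Rm) z).col 1 =
      ∑ m, (I * d.Fbar σ x t m * rho q₀ (d.θc m) / (z - d.θc m)) • (Rm (d.θc m)).col 0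
        - ∑ m, (I * d.Fhat σ x t m * rho q₀ (d.θic m) / (z - d.θic m)) • (Rp (d.θic m)).col 2 := by
  ext i
  simp only [principalPart_residues, hR.res_z, hR.res_zc, hR.res_θ, hR.res_θc, hR.res_θi,
    hR.res_θic]
  simp [Matrix.mul_apply, Fin.sum_univ_three, Matrix.sum_apply, div_eq_inv_mul, sub_eq_add_neg,
    mul_assoc, mul_comm, mul_left_comm]

theorem principalPart_col_two (hR : IsRHSolution σ x t qp qm d Rp Rm) (z : ℂ) :
    (principalPart d.point (residues d Rp Rm) z).col 2 =
      ∑ m, (I * d.Cbar σ x t m * rho q₀ (d.zc m) / (z - d.zc m)) • (Rm (d.zc m)).col 0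
        + ∑ m, (d.Fcheck σ x t m / (z - d.θi m)) • (Rm (d.θi m)).col 1 := by
  ext i
  simp only [principalPart_residues, hR.res_z, hR.res_zc, hR.res_θ, hR.res_θc, hR.res_θi,
    hR.res_θic]
  simp [Matrix.mul_apply, Fin.sum_univ_three, Matrix.sum_apply, div_eq_inv_mul, sub_eq_add_neg,
    mul_assoc, mul_comm, mul_left_comm]
end IsRHSolution

theorem theorem4_general (q₀ σ x t : ℝ) (hq₀ : 0 < q₀) (qp qm : Vec2)
    (hnonorth : inner ℂ qp qm ≠ (0 : ℂ))
    (M₁ M₂ : ℕ) (d : SpectralData q₀ M₁ M₂) (Rp Rm : ℂ → Mat3)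
    (hR : IsRHSolution σ x t qp qm d Rp Rm) :
    (∀ z : ℂ, z.im ≠ 0 → ∀ i j,
      Integrable fun s : ℝ => density σ x t qp qm d Rm s i j / ((s : ℂ) - z)) ∧
    (∀ z : ℂ, z.im ≠ 0 → z ∉ d.spectrum →
      sectional (Rp z) (Rm z) z =
        sectional (RinfPlus q₀ qp qm) (RinfMinus q₀ qp qm) z
          + z⁻¹ • sectional (RzeroPlus q₀) (RzeroMinus qm) z
          + cauchyIntegral (density σ x t qp qm d Rm) z
          + ∑ m, ((z - d.z m)⁻¹ • matResidue Rp (d.z m)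
              + (z - d.zc m)⁻¹ • matResidue Rm (d.zc m))
          + ∑ m, ((z - d.θ m)⁻¹ • matResidue Rp (d.θ m)
              + (z - d.θc m)⁻¹ • matResidue Rm (d.θc m))
          + ∑ m, ((z - d.θic m)⁻¹ • matResidue Rp (d.θic m)
              + (z - d.θi m)⁻¹ • matResidue Rm (d.θi m))) ∧
    (∀ z : ℂ, z.im < 0 →
      (Rm z).col 0 = ![1, qm 0 / z, qm 1 / z]
        + (cauchyIntegral (density σ x t qp qm d Rm) z).col 0
        + ∑ m, (I * d.C σ x t m * rho q₀ (d.z m) / (z - d.z m)) • (Rp (d.z m)).col 2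
        - ∑ m, (d.F σ x t m / (z - d.θ m)) • (Rp (d.θ m)).col 1) ∧
    (∀ z : ℂ, 0 < z.im →
      (Rp z).col 2 = ![-I * q₀ / z, -I * qm 0 / q₀, -I * qm 1 / q₀]
        + (cauchyIntegral (density σ x t qp qm d Rm) z).col 2
        + ∑ m, (I * d.Cbar σ x t m * rho q₀ (d.zc m) / (z - d.zc m)) • (Rm (d.zc m)).col 0
        + ∑ m, (d.Fcheck σ x t m / (z - d.θi m)) • (Rm (d.θi m)).col 1) ∧
    (∀ n, (Rp (d.θ n)).col 1 =
        ![0, q₀ * perp qp 0 / inner ℂ qp qm, q₀ * perp qp 1 / inner ℂ qp qm]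
        + (cauchyIntegral (density σ x t qp qm d Rm) (d.θ n)).col 1
        + ∑ m, (I * d.Fbar σ x t m * rho q₀ (d.θc m) / (d.θ n - d.θc m)) • (Rm (d.θc m)).col 0
        - ∑ m, (I * d.Fhat σ x t m * rho q₀ (d.θic m) / (d.θ n - d.θic m))
            • (Rp (d.θic m)).col 2) ∧
    (∀ n, (Rm (d.θi n)).col 1 =
        ![0, perp qm 0 / q₀, perp qm 1 / q₀]
        + (cauchyIntegral (density σ x t qp qm d Rm) (d.θi n)).col 1
        + ∑ m, (I * d.Fbar σ x t m * rho q₀ (d.θc m) / (d.θi n - d.θc m)) • (Rm (d.θc m)).col 0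
        - ∑ m, (I * d.Fhat σ x t m * rho q₀ (d.θic m) / (d.θi n - d.θic m))
            • (Rp (d.θic m)).col 2) := by
  have hspectral : ∀ {z : ℂ}, z ∉ d.spectrum → z ∉ Set.range d.point :=
    fun hsp => hsp ∘ fun hz => d.range_point_subset_spectrum hz
  refine ⟨fun z hz => hR.integrable_density_div_sub hq₀ hz, fun z hz hsp => ?_, fun z hz => ?_,
    fun z hz => ?_, fun n => ?_, fun n => ?_⟩
  · rw [hR.sectional_eq hq₀ hz (hspectral hsp), principalPart_residues]
    simp only [add_assoc]
  · rw [hR.col_minus hq₀ hz (by simp [SpectralData.polesMinus]),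
      RinfMinus_add_RzeroMinus_col_zero, hR.principalPart_col_zero, add_sub_assoc]
  · rw [hR.col_plus hq₀ hz (by simp [SpectralData.polesPlus]),
      RinfPlus_add_RzeroPlus_col_two, hR.principalPart_col_two, ← add_assoc]
  · rw [hR.col_plus hq₀ (d.θ_im_pos n) (d.θ_notMem_polesPlus_one hq₀ n),
      RinfPlus_add_RzeroPlus_col_one, hR.principalPart_col_one, add_sub_assoc]
  · rw [hR.col_minus hq₀ (d.θi_im_neg hq₀ n) (d.θi_notMem_polesMinus_one hq₀ n),
      RinfMinus_add_RzeroMinus_col_one, hR.principalPart_col_one, add_sub_assoc]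

end HirotaRH

end

open HirotaRH in
theorem theorem4 (q₀ σ x t : ℝ) (hq₀ : 0 < q₀) (qp qm : Vec2)
    (hqp : ‖qp‖ = q₀) (hqm : ‖qm‖ = q₀) (hnonorth : inner ℂ qp qm ≠ (0 : ℂ))
    (M₁ M₂ : ℕ) (d : SpectralData q₀ M₁ M₂) (Rp Rm : ℂ → Mat3)
    (hR : IsRHSolution σ x t qp qm d Rp Rm) :
    (∀ z : ℂ, z.im ≠ 0 → ∀ i j,
      Integrable fun s : ℝ => density σ x t qp qm d Rm s i j / ((s : ℂ) - z)) ∧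
    (∀ z : ℂ, z.im ≠ 0 → z ∉ d.spectrum →
      sectional (Rp z) (Rm z) z =
        sectional (RinfPlus q₀ qp qm) (RinfMinus q₀ qp qm) z
          + z⁻¹ • sectional (RzeroPlus q₀) (RzeroMinus qm) z
          + cauchyIntegral (density σ x t qp qm d Rm) z
          + ∑ m, ((z - d.z m)⁻¹ • matResidue Rp (d.z m)
              + (z - d.zc m)⁻¹ • matResidue Rm (d.zc m))
          + ∑ m, ((z - d.θ m)⁻¹ • matResidue Rp (d.θ m)
              + (z - d.θc m)⁻¹ • matResidue Rm (d.θc m))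
          + ∑ m, ((z - d.θic m)⁻¹ • matResidue Rp (d.θic m)
              + (z - d.θi m)⁻¹ • matResidue Rm (d.θi m))) ∧
    (∀ z : ℂ, z.im < 0 →
      (Rm z).col 0 = ![1, qm 0 / z, qm 1 / z]
        + (cauchyIntegral (density σ x t qp qm d Rm) z).col 0
        + ∑ m, (I * d.C σ x t m * rho q₀ (d.z m) / (z - d.z m)) • (Rp (d.z m)).col 2
        - ∑ m, (d.F σ x t m / (z - d.θ m)) • (Rp (d.θ m)).col 1) ∧
    (∀ z : ℂ, 0 < z.im →
      (Rp z).col 2 = ![-I * q₀ / z, -I * qm 0 / q₀, -I * qm 1 / q₀]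
        + (cauchyIntegral (density σ x t qp qm d Rm) z).col 2
        + ∑ m, (I * d.Cbar σ x t m * rho q₀ (d.zc m) / (z - d.zc m)) • (Rm (d.zc m)).col 0
        + ∑ m, (d.Fcheck σ x t m / (z - d.θi m)) • (Rm (d.θi m)).col 1) ∧
    (∀ n, (Rp (d.θ n)).col 1 =
        ![0, q₀ * perp qp 0 / inner ℂ qp qm, q₀ * perp qp 1 / inner ℂ qp qm]
        + (cauchyIntegral (density σ x t qp qm d Rm) (d.θ n)).col 1
        + ∑ m, (I * d.Fbar σ x t m * rho q₀ (d.θc m) / (d.θ n - d.θc m)) • (Rm (d.θc m)).col 0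
        - ∑ m, (I * d.Fhat σ x t m * rho q₀ (d.θic m) / (d.θ n - d.θic m))
            • (Rp (d.θic m)).col 2) ∧
    (∀ n, (Rm (d.θi n)).col 1 =
        ![0, perp qm 0 / q₀, perp qm 1 / q₀]
        + (cauchyIntegral (density σ x t qp qm d Rm) (d.θi n)).col 1
        + ∑ m, (I * d.Fbar σ x t m * rho q₀ (d.θc m) / (d.θi n - d.θc m)) • (Rm (d.θc m)).col 0
        - ∑ m, (I * d.Fhat σ x t m * rho q₀ (d.θic m) / (d.θi n - d.θic m))
            • (Rp (d.θic m)).col 2) := by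
  exact theorem4_general q₀ σ x t hq₀ qp qm hnonorth M₁ M₂ d Rp Rm hR
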